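/- **Model.** Fix $n\ge 1$. In an $n\times n$ input-queued switch, in each time slot $t=0,1,2,\dots$ there are queue lengths $\mathbf q(t)\in\mathbb Z_{\ge0}^{n\times n}$, a scheduling algorithm picks (possibly at random) a schedule $\mathbf s(t)$ in the set $\mathcal X$ of $n\times n$ permutation matrices, packets $\mathbf a(t)\in\mathbb Z_{\ge0}^{n\times n}$ arrive, and $q_{ij}(t+1)=\max\{0,\,q_{ij}(t)+a_{ij}(t)-s_{ij}(t)\}$. Let $\tilde{\mathcal H}_t=(\mathbf q(0),\mathbf s(0),\dots,\mathbf q(t),\mathbf s(t))$; $\mathbf a(t)$ is independent of $\tilde{\mathcal H}_t$. Write $\langle\mathbf x,\mathbf y\rangle=\sum_{i,j}x_{ij}y_{ij}$, with norm $\|\cdot\|$. The system depends on a parameter $\epsilon\in(0,1)$. *Arrivals.* For each $\epsilon$: for each pair $(i,j)$ the $a_{ij}(t)$ are i.i.d. in $t$; in each slot, $a_{ij}(t)$ and $a_{i'j'}(t)$ are independent for $(i,j)\ne(i',j')$; $a_{ij}(t)\le a_{\max}$ with $a_{\max}<\infty$ independent of $\epsilon$; and $\mathbb P(\mathbf a(t)=\mathbf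 0)>0$. Further, $\mathbb E[\mathbf a(t)]=(1-\epsilon)\boldsymbol\nu$ for a fixed doubly stochastic matrix $\boldsymbol\nu$ with all entries positive, and $\mathrm{Var}(a_{ij}(t))\to\tilde\sigma_{ij}^2$ as $\epsilon\downarrow0$ for all $i,j$. *State.* For each $\epsilon$ there is a time-homogeneous Markov chain $X(t)$ on a countable state space. Condition A.1: $X(t)$ is $\sigma(\tilde{\mathcal H}_t)$-measurable, irreducible and aperiodic. Condition A.2: there is a function $g$ with $\mathbf q(t)=g(X(t))$ such that $g^{-1}(A)$ is finite for every finite set $A$. The switch is *stable* if $X(t)$ is positive recurrent. $\bar{\mathbf q}$ denotes the limit in distribution of $\mathbf q(t)$ as $t\to\infty$. *Class $\Pi_2$.* The algorithm lies in $\Pi_2$ if for each $\epsilon$ the chain $X(t)$ satisfies A.1 and A.2, and there is a constant $W_2\ge0$, independent of $\epsilon$, such that for all $t\ge0$ and all states $x$ with $\mathbb P(X(t)=x)>0$, $$\mathbb E\big[\langle\mathbf q(t),\mathbf s(t)\rangle\,\big|\,X(t)=x\big]\ \ge\ \max_{\mathbf s\in\mathcal X}\langle g(x),\mathbf s\rangle-W_2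 .$$ *Cone.* Let $\mathcal K$ be the set of matrices with nonnegative entries in the linear span of the $2n$ matrices that have ones in one row, or in one column, and zeros elsewhere. Let $\mathbf x_{\perp\mathcal K}=\mathbf x-\mathbf x_{\|\mathcal K}$, where $\mathbf x_{\|\mathcal K}$ is the point of $\mathcal K$ nearest to $\mathbf x$. **Theorem.** Any scheduling algorithm in class $\Pi_2$ achieves state-space collapse, and its heavy-traffic behaviour is MaxWeight-like. That is: 1. (State-space collapse) for every $\epsilon\in(0,1)$ the chain $X(t)$ satisfies A.1 and A.2, the switch is stable, and $\mathbf q(t)$ converges in distribution to some $\bar{\mathbf q}$; and there are $\epsilon_0>0$ and constants $C_r<\infty$, independent of $\epsilon$, such that $$\mathbb E\big[\|\bar{\mathbf q}_{\perp\mathcal K}\|^r\big]\le C_r\qquad\text{for all } r\in\{1,2,\dots\}\text{ and all }\epsilon\in(0,1)\text{ with }\epsilon\le\epsilon_0 .$$ 2. (MaxWeight-like) $\mathbb E\big[\sum_{i,j}\bar q_{ij}\big]<\infty$ for every $\epsilon\in(0,1)$, and $$\lim_{\epsilon\downarrow0}\ \epsilon\,\mathbb E\Big[\sum_{i,j}\bar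 q_{ij}\Big]=\Big(1-\frac1{2n}\Big)\sum_{i,j}\tilde\sigma_{ij}^2 .$$ -/

import Mathlib

open MeasureTheory ProbabilityTheory Filter Topology
open scoped ENNReal

universe u v

namespace InputQueuedSwitch

/-! ### Matrices, schedules and weights -/

/-- `n × n` matrices of numbers of packets (with the product, i.e. discrete, topology). -/
abbrev PacketMatrix (n : ℕ) : Type := Fin n → Fin n → ℕ

/-- `ℝ^{n × n}` with the Frobenius inner product and norm. -/
abbrev RealMatrix (n : ℕ) : Type := EuclideanSpace ℝ (Fin n × Fin n)

/-- A packet matrix, seen in `ℝ^{n × n}`. -/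
noncomputable def toReal {n : ℕ} (q : PacketMatrix n) : RealMatrix n :=
  WithLp.toLp 2 fun p => (q p.1 p.2 : ℝ)

/-- The `0`-`1` matrix of the perfect matching that connects input `i` with output `σ i`. -/
def scheduleOf {n : ℕ} (σ : Equiv.Perm (Fin n)) : PacketMatrix n :=
  fun i j => if σ i = j then 1 else 0

/-- The set of possible schedules: all `n × n` permutation matrices. -/
def schedules (n : ℕ) : Set (PacketMatrix n) := Set.range scheduleOf

/-- The weight `⟨q, s⟩` of the schedule `s` at queue lengths `q`. -/
def weight {n : ℕ} (q s : PacketMatrix n) : ℕ := ∑ i, ∑ j, q i j * s i j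

/-- The largest weight of a schedule at queue lengths `q`. -/
def maxWeight {n : ℕ} (q : PacketMatrix n) : ℕ :=
  Finset.univ.sup fun σ : Equiv.Perm (Fin n) => weight q (scheduleOf σ)

/-! ### The cone of state-space collapse -/

/-- The matrix whose `i`-th row is all ones, with zeros elsewhere. -/
noncomputable def rowOnes {n : ℕ} (i : Fin n) : RealMatrix n :=
  WithLp.toLp 2 fun p => if p.1 = i then 1 else 0

/-- The matrix whose `j`-th column is all ones, with zeros elsewhere. -/
noncomputable def colOnes {n : ℕ} (j : Fin n) : RealMatrix n :=
  WithLp.toLp 2 fun p => if p.2 = j then 1 else 0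

/-- The subspace spanned by the row matrices and the column matrices. -/
noncomputable def collapseSpace (n : ℕ) : Submodule ℝ (RealMatrix n) :=
  Submodule.span ℝ (Set.range rowOnes ∪ Set.range colOnes)

/-- The cone `𝒦`: the intersection of `collapseSpace` with the nonnegative orthant. -/
def cone (n : ℕ) : Set (RealMatrix n) := {x | x ∈ collapseSpace n ∧ ∀ p, 0 ≤ x p}

theorem isClosed_cone (n : ℕ) : IsClosed (cone n) := by
  have h1 : IsClosed (collapseSpace n : Set (RealMatrix n)) :=
    Submodule.closed_of_finiteDimensional _
  have h2 : IsClosed {x : RealMatrix n | ∀ p, 0 ≤ x p} := by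
    simp only [Set.ofPred_forall]
    exact isClosed_iInter fun p => isClosed_le continuous_const (by fun_prop)
  exact h1.inter h2

theorem zero_mem_cone (n : ℕ) : (0 : RealMatrix n) ∈ cone n :=
  ⟨Submodule.zero_mem _, fun p => by simp⟩

/-- The cone has a point nearest to `x`. -/
theorem exists_nearest {n : ℕ} (x : RealMatrix n) :
    ∃ p ∈ cone n, ∀ y ∈ cone n, ‖x - p‖ ≤ ‖x - y‖ := by
  obtain ⟨p, hp, h⟩ := (isClosed_cone n).exists_infDist_eq_dist ⟨0, zero_mem_cone n⟩ x
  refine ⟨p, hp, fun y hy => ?_⟩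
  rw [← dist_eq_norm, ← dist_eq_norm, ← h]
  exact Metric.infDist_le_dist_of_mem hy

/-- The projection `x_{∥𝒦}` of `x` onto the cone: its (unique) nearest point in the cone. -/
noncomputable def projCone {n : ℕ} (x : RealMatrix n) : RealMatrix n :=
  (exists_nearest x).choose

/-- `x_{⊥𝒦} = x - x_{∥𝒦}`. -/
noncomputable def perpCone {n : ℕ} (x : RealMatrix n) : RealMatrix n := x - projCone x

/-! ### Countable Markov chains -/

section Chain

variable {S : Type v}

open Classical in
/-- The `k`-step transition probabilities of the transition matrix `P`. -/
noncomputable def stepProb (P : S → PMF S) : ℕ → S → S → ℝ≥0∞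
  | 0, x, y => if x = y then 1 else 0
  | k + 1, x, y => ∑' z, P x z * stepProb P k z y

/-- Every state can be reached from every state. -/
def Irreducible (P : S → PMF S) : Prop := ∀ x y, ∃ k, 0 < stepProb P k x y

/-- For every state, the possible return times have greatest common divisor `1`. -/
def Aperiodic (P : S → PMF S) : Prop :=
  ∀ x, ∀ d : ℕ, (∀ k, 1 ≤ k → 0 < stepProb P k x x → d ∣ k) → d = 1

open Classical in
/-- `firstPassage P x k y` is the probability that the chain started at `y` is at `x` at time `k`,
for the first time among the times `1, 2, …, k`. -/
noncomputable def firstPassage (P : S → PMF S) (x : S) : ℕ → S → ℝ≥0∞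
  | 0, _ => 0
  | 1, y => P y x
  | k + 2, y => ∑' z, if z = x then 0 else P y z * firstPassage P x (k + 1) z

/-- From every state the chain returns with probability one, and the mean return time is finite. -/
def PositiveRecurrent (P : S → PMF S) : Prop :=
  ∀ x, ∑' k, firstPassage P x k x = 1 ∧ ∑' k : ℕ, (k : ℝ≥0∞) * firstPassage P x k x < ∞

end Chain

/-! ### The switch -/

/-- The σ-algebra generated by the history `q(0), s(0), …, q(t), s(t)`. -/
abbrev historyOf {Ω : Type u} {n : ℕ} (q s : ℕ → Ω → PacketMatrix n) (t : ℕ) :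
    MeasurableSpace Ω :=
  (⨆ k ∈ Set.Iic t, MeasurableSpace.comap (q k) inferInstance) ⊔
    ⨆ k ∈ Set.Iic t, MeasurableSpace.comap (s k) inferInstance

/-- The processes of an `n × n` input-queued switch that is run by a scheduling algorithm: in slot
`t` there are queue lengths `q t`, the algorithm picks a schedule `s t`, and packets `a t` arrive.
The algorithm may use the past and additional randomness, and cannot foresee the arrivals. -/
structure SwitchSystem (n : ℕ) where
  Ω : Type u
  mΩ : MeasurableSpace Ω
  μ : Measure Ω
  isProb : IsProbabilityMeasure μ
  a : ℕ → Ω → PacketMatrix n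
  s : ℕ → Ω → PacketMatrix n
  q : ℕ → Ω → PacketMatrix n
  measurable_a : ∀ t, Measurable (a t)
  measurable_s : ∀ t, Measurable (s t)
  measurable_q : ∀ t, Measurable (q t)
  s_mem : ∀ t ω, s t ω ∈ schedules n
  /-- `q(t+1) = [q(t) + a(t) - s(t)]⁺`. -/
  q_succ : ∀ t ω i j, (q (t + 1) ω i j : ℤ) = max 0 ((q t ω i j : ℤ) + a t ω i j - s t ω i j)
  /-- The arrivals of slot `t` are independent of `q(0), s(0), …, q(t), s(t)`. -/
  indep_history : ∀ t,
    Indep (historyOf q s t) (MeasurableSpace.comap (a t) inferInstance) μ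

attribute [instance] SwitchSystem.mΩ SwitchSystem.isProb

namespace SwitchSystem

variable {n : ℕ} (M : SwitchSystem.{u} n)

/-- The assumptions on the arrivals. -/
structure ArrivalAssumption (amax : ℕ) : Prop where
  indep_time : ∀ i j, iIndepFun (fun t ω => M.a t ω i j) M.μ
  identDistrib : ∀ i j t, IdentDistrib (fun ω => M.a t ω i j) (fun ω => M.a 0 ω i j) M.μ M.μ
  indep_pair : ∀ t i j i' j', (i, j) ≠ (i', j') →
    IndepFun (fun ω => M.a t ω i j) (fun ω => M.a t ω i' j') M.μ
  bounded : ∀ t ω i j, M.a t ω i j ≤ amax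
  zero_pos : ∀ t, 0 < M.μ {ω | M.a t ω = 0}

/-- The mean arrival rate of the pair `(i, j)` (the arrivals are identically distributed in time,
so slot `0` is used). -/
noncomputable def arrivalRate (i j : Fin n) : ℝ := ∫ ω, (M.a 0 ω i j : ℝ) ∂M.μ

/-- The variance of the arrivals of the pair `(i, j)` in a slot. -/
noncomputable def arrivalVariance (i j : Fin n) : ℝ :=
  variance (fun ω => (M.a 0 ω i j : ℝ)) M.μ

/-- `Q` is the law of the steady-state queue lengths: `q(t)` converges in distribution to it. -/
def IsSteadyState (Q : ProbabilityMeasure (PacketMatrix n)) : Prop :=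
  TendstoInDistribution M.q atTop id (fun _ => M.μ) (Q : Measure (PacketMatrix n))

/-- A process `X` on the switch that is a time-homogeneous Markov chain on a countable state space
`S` with transition matrix `P`. -/
structure StateChain where
  S : Type v
  countable : Countable S
  X : ℕ → M.Ω → S
  measurableSet_eq : ∀ t x, MeasurableSet {ω | X t ω = x}
  P : S → PMF S
  markov : ∀ (t : ℕ) (x : ℕ → S) (y : S),
    M.μ {ω | (∀ k ≤ t, X k ω = x k) ∧ X (t + 1) ω = y} =
      M.μ {ω | ∀ k ≤ t, X k ω = x k} * P (x t) y

namespace StateChain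

variable {M} (Y : StateChain.{u, v} M)

/-- The switch is stable: the Markov chain is positive recurrent. -/
def Stable : Prop := PositiveRecurrent Y.P

/-- Condition A.1: `X t` is measurable with respect to the history `q(0), s(0), …, q(t), s(t)`,
and the chain is irreducible and aperiodic. -/
def CondA1 : Prop :=
  (∀ t, Measurable[historyOf M.q M.s t, ⊤] (Y.X t)) ∧ Irreducible Y.P ∧ Aperiodic Y.P

/-- Condition A.2: `q t = g (X t)`, and preimages of finite sets under `g` are finite. -/
def CondA2 (g : Y.S → PacketMatrix n) : Prop :=
  (∀ t ω, M.q t ω = g (Y.X t ω)) ∧ ∀ A : Set (PacketMatrix n), A.Finite → (g ⁻¹' A).Finite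

/-- `E[⟨q(t), s(t)⟩ | X(t) = x] ≥ max_s ⟨g x, s⟩ - W` in all slots `t` and for all states `x` that
have positive probability in slot `t`. -/
def NearMaxWeight (g : Y.S → PacketMatrix n) (W : ℝ) : Prop :=
  ∀ t x, M.μ {ω | Y.X t ω = x} ≠ 0 →
    (maxWeight (g x) : ℝ) - W ≤
      ∫ ω, (weight (M.q t ω) (M.s t ω) : ℝ) ∂(ProbabilityTheory.cond M.μ {ω | Y.X t ω = x})

end StateChain

end SwitchSystem

/-! ### Families of switches indexed by the heavy-traffic parameter -/

/-- The values of the heavy-traffic parameter `ε`. -/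
abbrev Param : Type := Set.Ioo (0 : ℝ) 1

/-- The filter `ε ↓ 0`. -/
def heavyTraffic : Filter Param := comap Subtype.val (𝓝[>] (0 : ℝ))

variable {n : ℕ}

/-- The class `Π₂`. The constant `W` does not depend on `ε`. -/
def ClassTwo (M : Param → SwitchSystem.{u} n)
    (Y : ∀ ε, SwitchSystem.StateChain.{u, v} (M ε)) : Prop :=
  ∃ W : ℝ, 0 ≤ W ∧ ∀ ε, (Y ε).CondA1 ∧ ∃ g, (Y ε).CondA2 g ∧ (Y ε).NearMaxWeight g W

/-- State-space collapse. The constants `C r` do not depend on `ε`. -/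
def AchievesSSC (M : Param → SwitchSystem.{u} n)
    (Y : ∀ ε, SwitchSystem.StateChain.{u, v} (M ε)) : Prop :=
  (∀ ε, (Y ε).Stable) ∧ (∀ ε, (Y ε).CondA1 ∧ ∃ g, (Y ε).CondA2 g) ∧
  ∃ Q : Param → ProbabilityMeasure (PacketMatrix n),
    (∀ ε, (M ε).IsSteadyState (Q ε)) ∧
    ∃ ε₀ : ℝ, 0 < ε₀ ∧ ∃ C : ℕ → ℝ, ∀ ε : Param, (ε : ℝ) ≤ ε₀ → ∀ r : ℕ, 1 ≤ r →
      Integrable (fun q => ‖perpCone (toReal q)‖ ^ r) (Q ε : Measure (PacketMatrix n)) ∧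
      ∫ q, ‖perpCone (toReal q)‖ ^ r ∂(Q ε : Measure (PacketMatrix n)) ≤ C r

/-- MaxWeight-like heavy-traffic behaviour, where `σsq` is the matrix of the limits of the arrival
variances: `lim ε E[∑ q̄ᵢⱼ] = (1 - 1/(2n)) ∑ σsqᵢⱼ` as `ε ↓ 0`. -/
def MaxWeightLike (M : Param → SwitchSystem.{u} n) (σsq : Fin n → Fin n → ℝ) : Prop :=
  ∃ Q : Param → ProbabilityMeasure (PacketMatrix n),
    (∀ ε, (M ε).IsSteadyState (Q ε)) ∧
    (∀ ε, Integrable (fun q => ∑ i, ∑ j, (q i j : ℝ)) (Q ε : Measure (PacketMatrix n))) ∧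
    Tendsto
      (fun ε : Param =>
        (ε : ℝ) * ∫ q, (∑ i, ∑ j, (q i j : ℝ)) ∂(Q ε : Measure (PacketMatrix n)))
      heavyTraffic (𝓝 ((1 - 1 / (2 * (n : ℝ))) * ∑ i, ∑ j, σsq i j))

end InputQueuedSwitch

/-! A function with a geometric drift towards a finite set makes an irreducible aperiodic
transition matrix contract a weighted distance between laws; this yields the limit law, which
inherits the bound on the mean of the function that the drift maintains. For the switch the
function is `exp (θ ‖q‖)`: since `ν` has positive entries, a schedule of almost maximal weight
removes a positive amount per slot from `‖q‖` when `q` is large.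

The norm `‖q_⊥‖` of the part of `q` off the cone also has a negative drift, and this one does not
vanish with `ε`: off the cone, the largest weight of a schedule exceeds `⟨q, ν⟩` by a multiple of
`‖q_⊥‖`. Hence the steady-state moments of `q_⊥` are bounded uniformly in `ε`.

In steady state the squared norm of the projection of `q` onto the space spanned by the cone has
zero mean drift. The terms of this drift are a multiple of `ε E[∑ qᵢⱼ]`, the variances of the
arrivals, and cross terms with the unused services. A queue with an unused service is empty, so such
a cross term only involves `q_⊥`; since the mean unused service is of order `ε`, it vanishes in the
limit. -/

namespace InputQueuedSwitch

open scoped NNReal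

/-! ### Means under discrete laws and iterated transitions -/

section Mean

variable {S T : Type*}

/-- The mean `∑ p(x) f(x)` of a `[0, ∞]`-valued function `f` under the discrete law `p`; no
σ-algebra on `S` is involved. -/
noncomputable def mean (p : PMF S) (f : S → ℝ≥0∞) : ℝ≥0∞ := ∑' x, p x * f x

theorem mean_mono (p : PMF S) {f g : S → ℝ≥0∞} (h : ∀ x, f x ≤ g x) : mean p f ≤ mean p g :=
  ENNReal.tsum_le_tsum fun x => mul_le_mul_right (h x) (p x)

theorem mean_add (p : PMF S) (f g : S → ℝ≥0∞) :
    mean p (fun x => f x + g x) = mean p f + mean p g := by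
  simp only [mean, mul_add, ENNReal.tsum_add]

theorem mean_const_mul (p : PMF S) (c : ℝ≥0∞) (f : S → ℝ≥0∞) :
    mean p (fun x => c * f x) = c * mean p f := by
  simp only [mean, mul_left_comm, ENNReal.tsum_mul_left]

@[simp]
theorem mean_const (p : PMF S) (c : ℝ≥0∞) : mean p (fun _ => c) = c := by
  simp only [mean, ENNReal.tsum_mul_right, p.tsum_coe, one_mul]

theorem mean_le_one (p : PMF S) {φ : S → ℝ≥0∞} (hφ : ∀ u, φ u ≤ 1) : mean p φ ≤ 1 :=
  (mean_mono p hφ).trans (mean_const p 1).le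

theorem mean_ite_mem (p : PMF S) (F : Finset S) [DecidablePred (· ∈ F)] :
    mean p (fun x => if x ∈ F then 1 else 0) = ∑ x ∈ F, p x := by
  rw [mean, tsum_eq_sum (s := F) fun x hx => by simp [hx]]
  exact Finset.sum_congr rfl fun x hx => by simp [hx]

theorem mean_ite_eq [DecidableEq S] (p : PMF S) (x : S) :
    mean p (fun y => if y = x then 1 else 0) = p x := by
  simp [mean]

theorem mean_pure (x : S) (f : S → ℝ≥0∞) : mean (PMF.pure x) f = f x := by
  classical
  simp [mean, PMF.pure_apply]

theorem mean_bind (p : PMF S) (K : S → PMF T) (f : T → ℝ≥0∞) :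
    mean (p.bind K) f = mean p fun x => mean (K x) f := by
  simp only [mean, PMF.bind_apply, ← ENNReal.tsum_mul_left, ← ENNReal.tsum_mul_right]
  rw [ENNReal.tsum_comm]
  simp only [mul_assoc]

theorem mean_finsetSum {ι : Type*} (p : PMF S) (F : Finset ι) (f : ι → S → ℝ≥0∞) :
    mean p (fun x => ∑ i ∈ F, f i x) = ∑ i ∈ F, mean p (f i) := by
  simp only [mean, Finset.mul_sum]
  exact Summable.tsum_finsetSum fun _ _ => ENNReal.summable

theorem mean_eq_lintegral [MeasurableSpace S] [MeasurableSingletonClass S] [Countable S]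
    (p : PMF S) (f : S → ℝ≥0∞) : mean p f = ∫⁻ x, f x ∂p.toMeasure := by
  rw [lintegral_countable', mean]
  exact tsum_congr fun x => by
    rw [PMF.toMeasure_apply_singleton _ _ (measurableSet_singleton x), mul_comm]

/-- The law after `k` transitions of the chain with transition matrix `P`, as a function of the
initial state. -/
noncomputable def step (P : S → PMF S) : ℕ → S → PMF S
  | 0 => PMF.pure
  | k + 1 => fun x => (P x).bind (step P k)

theorem step_apply (P : S → PMF S) (k : ℕ) (x y : S) : step P k x y = stepProb P k x y := by
  induction k generalizing x with
  | zero => by_cases h : x = y <;> simp [step, stepProb, h, Ne.symm]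
  | succ k ih => simp only [step, stepProb, PMF.bind_apply, ih]

theorem step_one (P : S → PMF S) (x : S) : step P 1 x = P x :=
  PMF.bind_pure _

theorem step_add (P : S → PMF S) (j k : ℕ) (x : S) :
    step P (j + k) x = (step P j x).bind (step P k) := by
  induction j generalizing x with
  | zero => rw [zero_add]; exact (PMF.pure_bind _ _).symm
  | succ j ih => rw [Nat.add_right_comm, step, step, PMF.bind_bind]; exact congrArg _ (funext ih)

theorem mul_le_step_add (P : S → PMF S) (j k : ℕ) (x y z : S) :
    step P j x z * step P k z y ≤ step P (j + k) x y := by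
  rw [step_add, PMF.bind_apply]
  exact ENNReal.le_tsum z

/-- The geometric (Foster–Lyapunov) drift inequality `E[f(X(t+1)) | X(t) = x] ≤ γ f(x) + b`. -/
def GeometricDrift (P : S → PMF S) (f : S → ℝ≥0) (γ b : ℝ≥0) : Prop :=
  ∀ x, mean (P x) (fun y => (f y : ℝ≥0∞)) ≤ γ * f x + b

theorem exists_drift_fixed_point {γ : ℝ≥0} (hγ : γ < 1) (b : ℝ≥0) : ∃ c : ℝ≥0, γ * c + b = c := by
  have h : 1 - γ ≠ 0 := (tsub_pos_of_lt hγ).ne'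
  refine ⟨b / (1 - γ), ?_⟩
  calc γ * (b / (1 - γ)) + b = (γ + (1 - γ)) * (b / (1 - γ)) := by
        rw [add_mul, mul_div_cancel₀ _ h]
    _ = b / (1 - γ) := by rw [add_tsub_cancel_of_le hγ.le, one_mul]

namespace GeometricDrift

variable {P : S → PMF S} {f : S → ℝ≥0} {γ b c : ℝ≥0}

theorem mean_step_le (h : GeometricDrift P f γ b) (hc : γ * c + b = c) (k : ℕ) (x : S) :
    mean (step P k x) (fun y => (f y : ℝ≥0∞)) ≤ (γ : ℝ≥0∞) ^ k * f x + c := by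
  induction k with
  | zero => simp [step, mean_pure]
  | succ k ih =>
    calc mean (step P (k + 1) x) (fun y => (f y : ℝ≥0∞))
        = mean (step P k x) fun y => mean (P y) fun z => (f z : ℝ≥0∞) := by
          simp only [step_add, mean_bind, step_one]
      _ ≤ mean (step P k x) fun y => (γ : ℝ≥0∞) * f y + b := mean_mono _ h
      _ = γ * mean (step P k x) (fun y => (f y : ℝ≥0∞)) + b := by
          rw [mean_add, mean_const_mul, mean_const]
      _ ≤ γ * ((γ : ℝ≥0∞) ^ k * f x + c) + b := by gcongr
      _ = (γ : ℝ≥0∞) ^ (k + 1) * f x + (γ * c + b : ℝ≥0) := by push_cast; ring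
      _ = (γ : ℝ≥0∞) ^ (k + 1) * f x + c := by rw [hc]

theorem mean_step_le_add (h : GeometricDrift P f γ b) (hγ : γ < 1) (hc : γ * c + b = c) (k : ℕ)
    (x : S) : mean (step P k x) (fun y => (f y : ℝ≥0∞)) ≤ f x + c := by
  refine (h.mean_step_le hc k x).trans ?_
  gcongr
  exact mul_le_of_le_one_left (by simp) (pow_le_one' (by exact_mod_cast hγ.le) _)

theorem iterate (h : GeometricDrift P f γ b) (hγ : γ < 1) (hc : γ * c + b = c) {k : ℕ}
    (hk : k ≠ 0) : GeometricDrift (step P k) f γ c := fun x => by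
  refine (h.mean_step_le hc k x).trans ?_
  gcongr
  exact pow_le_of_le_one (by simp) (by exact_mod_cast hγ.le) hk

end GeometricDrift

end Mean

/-! ### Contraction in a weighted distance -/

section Contraction

variable {S : Type*}

open Classical in
/-- The weighted discrete distance `1_{x ≠ y} (2 + β V(x) + β V(y))` of Hairer and Mattingly. -/
noncomputable def weightedDist (V : S → ℝ≥0) (β : ℝ≥0) (x y : S) : ℝ≥0∞ :=
  if x = y then 0 else 2 + β * (V x + V y)

theorem weightedDist_of_ne (V : S → ℝ≥0) (β : ℝ≥0) {x y : S} (h : x ≠ y) :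
    weightedDist V β x y = 2 + β * (V x + V y) := if_neg h

theorem weightedDist_le (V : S → ℝ≥0) (β : ℝ≥0) (x y : S) :
    weightedDist V β x y ≤ 2 + β * (V x + V y) := by
  unfold weightedDist; split_ifs <;> simp

theorem le_add_weightedDist (V : S → ℝ≥0) (β : ℝ≥0) {φ : S → ℝ≥0∞} (hφ : ∀ x, φ x ≤ 1) (x y : S) :
    φ x ≤ φ y + weightedDist V β x y := by
  rcases eq_or_ne x y with rfl | hxy
  · exact le_self_add
  · calc φ x ≤ 2 := (hφ x).trans one_le_two
      _ ≤ 2 + β * (V x + V y) := le_self_add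
      _ ≤ φ y + weightedDist V β x y := by rw [weightedDist_of_ne V β hxy]; exact le_add_self

/-- The mean distance of independent points with laws `p` and `q`. -/
noncomputable def meanDist (d : S → S → ℝ≥0∞) (p q : PMF S) : ℝ≥0∞ :=
  mean p fun u => mean q fun v => d u v

theorem meanDist_mono {d d' : S → S → ℝ≥0∞} (h : ∀ x y, d x y ≤ d' x y) (p q : PMF S) :
    meanDist d p q ≤ meanDist d' p q :=
  mean_mono _ fun u => mean_mono _ (h u)

theorem mean_le_mean_add_meanDist {d : S → S → ℝ≥0∞} {φ : S → ℝ≥0∞} {c : ℝ≥0∞}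
    (h : ∀ x y, φ x ≤ φ y + c * d x y) (p q : PMF S) :
    mean p φ ≤ mean q φ + c * meanDist d p q := by
  have hq : ∀ u, φ u ≤ mean q φ + c * mean q (d u) := fun u => by
    rw [← mean_const_mul, ← mean_add, ← mean_const q (φ u)]
    exact mean_mono q (h u)
  calc mean p φ ≤ mean p fun u => mean q φ + c * mean q (d u) := mean_mono p hq
    _ = mean q φ + c * meanDist d p q := by rw [mean_add, mean_const, mean_const_mul, meanDist]

/-- The mass that both laws put on `z` is coupled at distance `0`. -/
theorem meanDist_weightedDist_add_le (V : S → ℝ≥0) (β : ℝ≥0) (p q : PMF S) (z : S) :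
    meanDist (weightedDist V β) p q + p z * q z * 2
      ≤ 2 + β * (mean p (fun u => (V u : ℝ≥0∞)) + mean q fun v => (V v : ℝ≥0∞)) := by
  classical
  let both (u v : S) : ℝ≥0∞ := 2 * (if u = z then 1 else 0) * if v = z then 1 else 0
  have hboth : meanDist both p q = p z * q z * 2 := by
    have hq : ∀ u, mean q (both u) = 2 * q z * if u = z then 1 else 0 := fun u => by
      rw [mean_const_mul, mean_ite_eq]; ring
    simp only [meanDist, hq, mean_const_mul, mean_ite_eq]
    ring
  have hle : ∀ u v, weightedDist V β u v + both u v ≤ 2 + β * (V u + V v) := fun u v => by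
    by_cases h : u = z ∧ v = z
    · simp [both, h.1, h.2, weightedDist]
    · have : both u v = 0 := by
        rcases not_and_or.1 h with h | h <;> simp [both, h]
      simpa [this] using weightedDist_le V β u v
  calc meanDist (weightedDist V β) p q + p z * q z * 2
      = meanDist (fun u v => weightedDist V β u v + both u v) p q := by
        rw [← hboth]; simp only [meanDist, mean_add]
    _ ≤ meanDist (fun u v => 2 + β * (V u + V v)) p q := meanDist_mono hle p q
    _ = _ := by simp only [meanDist, mean_add, mean_const_mul, mean_const]

/-- With `s = V(x) + V(y)`, the mean weighted distance after a transition is at most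
`2 + β (γ s + 2 b)`, and `2 α²` less if `s ≤ R`. -/
theorem exists_contraction_constants {γ b α R : ℝ} (hγ : γ < 1) (hγ0 : 0 ≤ γ) (hb : 0 ≤ b)
    (hα : 0 < α) (hR : R * (1 - γ) = 4 * b + 1) :
    ∃ β ρ : ℝ, 0 ≤ β ∧ 0 ≤ ρ ∧ ρ < 1 ∧
      (∀ s, R ≤ s → 2 + β * (γ * s + 2 * b) ≤ ρ * (2 + β * s)) ∧
      ∀ s, 0 ≤ s → 2 + β * (γ * s + 2 * b) ≤ ρ * (2 + β * s) + α * α * 2 := by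
  have hγ' : 0 < 1 - γ := sub_pos.2 hγ
  have hRpos : 0 ≤ R := nonneg_of_mul_nonneg_left (by rw [hR]; positivity) hγ'
  obtain ⟨β, hβ, hβb⟩ : ∃ β : ℝ, 0 < β ∧ β * (2 * b + 1) = α * α :=
    ⟨α * α / (2 * b + 1), by positivity, div_mul_cancel₀ _ (by positivity)⟩
  have hRβ : β * (1 - γ) * R = β * (4 * b + 1) := by rw [← hR]; ring
  obtain ⟨κ, hκ, hκα, hκγ, hκR⟩ : ∃ κ : ℝ, 0 < κ ∧ κ ≤ α * α / 2 ∧ κ ≤ (1 - γ) / 4 ∧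
      κ ≤ β * (1 - γ) * R / 8 :=
    ⟨min (α * α / 2) (min ((1 - γ) / 4) (β * (1 - γ) * R / 8)),
      lt_min (by positivity) (lt_min (by positivity) (by rw [hRβ]; positivity)),
      min_le_left _ _, (min_le_right _ _).trans (min_le_left _ _),
      (min_le_right _ _).trans (min_le_right _ _)⟩
  refine ⟨β, 1 - κ, hβ.le, by linarith, by linarith, fun s hs => ?_, fun s hs => ?_⟩
  · have hκs : κ * (β * s) ≤ (1 - γ) / 4 * (β * s) := by
      have : 0 ≤ s := hRpos.trans hs
      gcongr
    have hRs : β * (1 - γ) * R ≤ β * (1 - γ) * s := by gcongr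
    linarith
  · have hκs : κ * (β * s) ≤ (1 - γ) * (β * s) := by gcongr; linarith
    linarith [hκα]

theorem GeometricDrift.exists_meanDist_le {K : S → PMF S} {V : S → ℝ≥0} {γ b α R : ℝ≥0}
    (hV : GeometricDrift K V γ b) (hγ : γ < 1) (hα : 0 < α) (hR : R * (1 - (γ : ℝ)) = 4 * b + 1)
    {z : S} (hz : ∀ x, V x ≤ R → (α : ℝ≥0∞) ≤ K x z) :
    ∃ β ρ : ℝ≥0, ρ < 1 ∧ ∀ x y, x ≠ y →
      meanDist (weightedDist V β) (K x) (K y) ≤ ρ * weightedDist V β x y := by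
  obtain ⟨β, ρ, hβ, hρ0, hρ, hlarge, hsmall⟩ := exists_contraction_constants (γ := γ) (b := b)
    (α := α) (R := R) (by exact_mod_cast hγ) γ.2 b.2 (by exact_mod_cast hα) hR
  lift β to ℝ≥0 using hβ
  lift ρ to ℝ≥0 using hρ0
  refine ⟨β, ρ, by exact_mod_cast hρ, fun x y hxy => ?_⟩
  rw [weightedDist_of_ne V β hxy]
  have hdrift : meanDist (weightedDist V β) (K x) (K y) + K x z * K y z * 2
      ≤ 2 + β * (γ * (V x + V y) + 2 * b) := by
    calc _ ≤ (2 : ℝ≥0∞) + β * ((γ * V x + b) + (γ * V y + b)) := by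
          grw [meanDist_weightedDist_add_le, hV x, hV y]
      _ = _ := by ring
  by_cases hs : R ≤ V x + V y
  · refine (le_self_add.trans hdrift).trans ?_
    exact_mod_cast hlarge (V x + V y) (by exact_mod_cast hs)
  · have hx : V x ≤ R := le_self_add.trans (not_le.1 hs).le
    have hy : V y ≤ R := le_add_self.trans (not_le.1 hs).le
    have hgain : (2 : ℝ≥0∞) + β * (γ * (V x + V y) + 2 * b)
        ≤ ρ * (2 + β * (V x + V y)) + α * α * 2 := by
      exact_mod_cast hsmall (V x + V y) (by positivity)
    have hmeet : (α * α * 2 : ℝ≥0∞) ≤ K x z * K y z * 2 := by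
      gcongr <;> [exact hz x hx; exact hz y hy]
    refine (ENNReal.add_le_add_iff_right (a := α * α * 2) (by finiteness)).1 ?_
    exact (by gcongr : _ ≤ _).trans (hdrift.trans hgain)

theorem mean_step_mul_le_add {P : S → PMF S} {m : ℕ} {d : S → S → ℝ≥0∞} {ρ : ℝ≥0}
    (hd : ∀ x y, x ≠ y → meanDist d (step P m x) (step P m y) ≤ ρ * d x y) {φ : S → ℝ≥0∞}
    (hφ : ∀ x y, φ x ≤ φ y + d x y) (k : ℕ) (x y : S) :
    mean (step P (m * k) x) φ ≤ mean (step P (m * k) y) φ + (ρ : ℝ≥0∞) ^ k * d x y := by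
  induction k generalizing x y with
  | zero => simpa [step, mean_pure] using hφ x y
  | succ k ih =>
    rcases eq_or_ne x y with rfl | hxy
    · exact le_self_add
    rw [Nat.mul_succ, add_comm, step_add, step_add, mean_bind, mean_bind, pow_succ, mul_assoc]
    exact (mean_le_mean_add_meanDist ih _ _).trans (by gcongr; exact hd x y hxy)

end Contraction

/-! ### Limit laws and positive recurrence -/

section Recurrence

variable {S : Type*} {P : S → PMF S}

theorem exists_forall_ge_step_pos (hI : Irreducible P) (hA : Aperiodic P) (x z : S) :
    ∃ N, ∀ m ≥ N, 0 < step P m x z := by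
  simp only [Irreducible, Aperiodic, ← step_apply] at hI hA
  let T : Set ℕ := {k | 1 ≤ k ∧ 0 < step P k z z}
  have hgcd : Nat.setGcd T = 1 :=
    hA z _ fun k hk hpos => Nat.setGcd_dvd_of_mem ⟨hk, hpos⟩
  have hreturn : ∀ k ∈ AddSubmonoid.closure T, 0 < step P k z z := fun k hk => by
    refine AddSubmonoid.closure_induction (fun k hk => hk.2) ?_ (fun i j _ _ hi hj => ?_) hk
    · classical simp [step, PMF.pure_apply]
    · exact (ENNReal.mul_pos hi.ne' hj.ne').trans_le (mul_le_step_add P i j z z z)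
  obtain ⟨N, hN⟩ := Nat.exists_mem_closure_of_ge T
  obtain ⟨k, hk⟩ := hI x z
  refine ⟨k + N, fun m hm => ?_⟩
  obtain ⟨i, rfl⟩ := Nat.exists_eq_add_of_le (Nat.le_of_add_right_le hm)
  have hi : 0 < step P i z z := hreturn i (hN i (by omega) (by rw [hgcd]; exact one_dvd _))
  exact (ENNReal.mul_pos hk.ne' hi.ne').trans_le (mul_le_step_add P k i x z z)

theorem exists_minorization (hI : Irreducible P) (hA : Aperiodic P) {C : Set S} (hC : C.Finite)
    (z : S) : ∃ m ≠ 0, ∃ α : ℝ≥0, 0 < α ∧ ∀ x ∈ C, (α : ℝ≥0∞) ≤ step P m x z := by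
  obtain ⟨m, hm, hpos⟩ : ∃ m ≠ 0, ∀ x ∈ C, 0 < step P m x z := by
    choose N hN using fun x => exists_forall_ge_step_pos hI hA x z
    obtain ⟨B, hB⟩ := (hC.image N).bddAbove
    exact ⟨B + 1, B.succ_ne_zero, fun x hx => hN x _ ((hB ⟨x, hx, rfl⟩).trans B.le_succ)⟩
  refine ⟨m, hm, ?_⟩
  rcases C.eq_empty_or_nonempty with rfl | hne
  · exact ⟨1, one_pos, by simp⟩
  obtain ⟨x₀, hx₀, hmin⟩ := Set.exists_min_image C (fun x => step P m x z) hC hne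
  exact ⟨(step P m x₀ z).toNNReal, ENNReal.toNNReal_pos (hpos x₀ hx₀).ne' (PMF.apply_ne_top _ _),
    fun x hx => ENNReal.coe_toNNReal_le_self.trans (hmin x hx)⟩

/-- The chain forgets its start at rate `e`: as a law, `X(t)` started at `z` is `e t x z`-close to
any later `X(t + j)` started at `x`. One inequality suffices, as `φ` may be replaced by `1 - φ`. -/
structure ForgetsStart (P : S → PMF S) (e : ℕ → S → S → ℝ≥0∞) : Prop where
  tendsto_zero : ∀ x z, Tendsto (e · x z) atTop (𝓝 0)
  mean_le : ∀ φ : S → ℝ≥0∞, (∀ u, φ u ≤ 1) → ∀ t j x z,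
    mean (step P (t + j) x) φ ≤ mean (step P t z) φ + e t x z

theorem ForgetsStart.le_mean {e : ℕ → S → S → ℝ≥0∞} (he : ForgetsStart P e) {φ : S → ℝ≥0∞}
    (hφ : ∀ u, φ u ≤ 1) (t j : ℕ) (x z : S) :
    mean (step P t z) φ ≤ mean (step P (t + j) x) φ + e t x z := by
  have hcompl : ∀ p : PMF S, mean p φ + mean p (fun u => 1 - φ u) = 1 := fun p => by
    rw [← mean_add]
    exact (congrArg _ (funext fun u => add_tsub_cancel_of_le (hφ u))).trans (mean_const p 1)
  have hφ' : ∀ u, 1 - φ u ≤ 1 := fun u => tsub_le_self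
  refine (ENNReal.add_le_add_iff_right
    (ne_top_of_le_ne_top ENNReal.one_ne_top (mean_le_one (step P t z) hφ'))).1 ?_
  calc mean (step P t z) φ + mean (step P t z) (fun u => 1 - φ u)
      = mean (step P (t + j) x) φ + mean (step P (t + j) x) (fun u => 1 - φ u) := by
        rw [hcompl, hcompl]
    _ ≤ mean (step P (t + j) x) φ + (mean (step P t z) (fun u => 1 - φ u) + e t x z) := by
        gcongr
        exact he.mean_le _ hφ' t j x z
    _ = _ := by ring

theorem GeometricDrift.forgetsStart {V : S → ℝ≥0} {γ b c β ρ : ℝ≥0} {m : ℕ}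
    (hV : GeometricDrift P V γ b) (hγ : γ < 1) (hc : γ * c + b = c) (hm : m ≠ 0) (hρ : ρ < 1)
    (hd : ∀ x y, x ≠ y →
      meanDist (weightedDist V β) (step P m x) (step P m y) ≤ ρ * weightedDist V β x y) :
    ForgetsStart P fun t x z => (ρ : ℝ≥0∞) ^ (t / m) * (2 + β * ((V x + c) + V z)) where
  tendsto_zero x z := by
    have h := (ENNReal.tendsto_pow_atTop_nhds_zero_of_lt_one (r := ρ) (by exact_mod_cast hρ)).comp
      (Nat.tendsto_div_const_atTop hm)
    simpa using ENNReal.Tendsto.mul_const h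
      (Or.inr (by finiteness : (2 + β * ((V x + c) + V z) : ℝ≥0∞) ≠ ∞))
  mean_le φ hφ t j x z := by
    have hosc : ∀ u, mean (step P t u) φ
        ≤ mean (step P t z) φ + (ρ : ℝ≥0∞) ^ (t / m) * weightedDist V β u z := fun u => by
      have h := mean_step_mul_le_add hd (le_add_weightedDist V β fun w =>
        mean_le_one (step P (t % m) w) hφ) (t / m) u z
      simpa only [← mean_bind, ← step_add, Nat.div_add_mod] using h
    calc mean (step P (t + j) x) φ
        = mean (step P j x) fun u => mean (step P t u) φ := by
          rw [add_comm, step_add, mean_bind]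
      _ ≤ mean (step P j x) fun u =>
            mean (step P t z) φ + (ρ : ℝ≥0∞) ^ (t / m) * (2 + β * (V u + V z)) :=
          mean_mono _ fun u => (hosc u).trans (by gcongr; exact weightedDist_le V β u z)
      _ = mean (step P t z) φ + (ρ : ℝ≥0∞) ^ (t / m)
            * (2 + β * (mean (step P j x) (fun u => (V u : ℝ≥0∞)) + V z)) := by
          simp only [mean_add, mean_const_mul, mean_const]
      _ ≤ _ := by gcongr; exact hV.mean_step_le_add hγ hc j x

theorem exists_forgetsStart [Nonempty S] (hI : Irreducible P) (hA : Aperiodic P) {V : S → ℝ≥0}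
    {γ b : ℝ≥0} (hγ : γ < 1) (hV : GeometricDrift P V γ b) (hfin : ∀ R, {x | V x ≤ R}.Finite) :
    ∃ e, ForgetsStart P e := by
  obtain ⟨c, hc⟩ := exists_drift_fixed_point hγ b
  have hγ' : 0 < 1 - (γ : ℝ) := sub_pos.2 (by exact_mod_cast hγ)
  obtain ⟨R, hR⟩ : ∃ R : ℝ≥0, R * (1 - (γ : ℝ)) = 4 * c + 1 :=
    ⟨⟨(4 * c + 1) / (1 - γ), by positivity⟩, div_mul_cancel₀ _ hγ'.ne'⟩
  obtain ⟨z⟩ := ‹Nonempty S›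
  obtain ⟨m, hm, α, hα, hmin⟩ := exists_minorization hI hA (hfin R) z
  obtain ⟨β, ρ, hρ, hcontr⟩ := (hV.iterate hγ hc hm).exists_meanDist_le hγ hα hR hmin
  exact ⟨_, hV.forgetsStart hγ hc hm hρ hcontr⟩

/-- The law of `X(t)` converges to `π` pointwise, whatever the initial state. -/
def IsLimitLaw (P : S → PMF S) (π : PMF S) : Prop :=
  ∀ x y, Tendsto (fun t => step P t x y) atTop (𝓝 (π y))

theorem ForgetsStart.exists_tendsto [Nonempty S] {e : ℕ → S → S → ℝ≥0∞} (he : ForgetsStart P e)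
    (y : S) : ∃ l, ∀ x, Tendsto (fun t => step P t x y) atTop (𝓝 l) := by
  classical
  have hle : ∀ t j x z, step P (t + j) x y ≤ step P t z y + e t x z := fun t j x z => by
    have h := he.mean_le (fun u => if u = y then 1 else 0) (fun u => by split_ifs <;> simp) t j x z
    simpa only [mean_ite_eq] using h
  have hlimsup : ∀ x z,
      limsup (fun t => step P t x y) atTop ≤ liminf (fun t => step P t z y) atTop := fun x z => by
    refine ENNReal.le_of_forall_pos_le_add fun ε hε _ => ?_
    rw [← tsub_le_iff_right]
    refine le_liminf_of_le (by isBoundedDefault) ?_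
    filter_upwards [(he.tendsto_zero x z).eventually_le_const (ENNReal.coe_pos.2 hε)]
      with t ht
    rw [tsub_le_iff_right]
    refine limsup_le_of_le (by isBoundedDefault) ?_
    filter_upwards [eventually_ge_atTop t] with s hs
    obtain ⟨j, rfl⟩ := Nat.exists_eq_add_of_le hs
    exact (hle t j x z).trans (by gcongr)
  obtain ⟨z⟩ := ‹Nonempty S›
  exact ⟨liminf (fun t => step P t z y) atTop, fun x =>
    tendsto_of_le_liminf_of_limsup_le ((liminf_le_limsup).trans (hlimsup z x)) (hlimsup x z)⟩

theorem ForgetsStart.exists_isLimitLaw [Nonempty S] {e : ℕ → S → S → ℝ≥0∞}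
    (he : ForgetsStart P e) : ∃ π, IsLimitLaw P π := by
  classical
  choose l hl using he.exists_tendsto
  obtain ⟨z⟩ := ‹Nonempty S›
  have hsum : ∀ F : Finset S, Tendsto (fun t => ∑ y ∈ F, step P t z y) atTop (𝓝 (∑ y ∈ F, l y)) :=
    fun F => tendsto_finsetSum F fun y _ => hl y z
  have hle : ∑' y, l y ≤ 1 := by
    rw [ENNReal.tsum_eq_iSup_sum]
    exact iSup_le fun F => le_of_tendsto' (hsum F) fun t =>
      (ENNReal.sum_le_tsum F).trans (step P t z).tsum_coe.le
  -- no mass escapes: on every finite set the law at time `t` is close to the limit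
  have hfin : ∀ (F : Finset S) t, ∑ y ∈ F, step P t z y ≤ ∑' y, l y + e t z z := fun F t => by
    have hj : ∀ j, ∑ y ∈ F, step P t z y ≤ ∑ y ∈ F, step P (j + t) z y + e t z z := fun j => by
      have h := he.le_mean (φ := fun u => if u ∈ F then 1 else 0) (fun u => by split_ifs <;> simp)
        t j z z
      simpa only [mean_ite_mem, add_comm t] using h
    refine (ge_of_tendsto' (((hsum F).comp (tendsto_add_atTop_nat t)).add_const _) hj).trans ?_
    gcongr
    exact ENNReal.sum_le_tsum F
  have hge : 1 ≤ ∑' y, l y := by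
    have ht : ∀ t, 1 ≤ ∑' y, l y + e t z z := fun t => by
      rw [← (step P t z).tsum_coe, ENNReal.tsum_eq_iSup_sum]
      exact iSup_le fun F => hfin F t
    simpa using ge_of_tendsto' ((he.tendsto_zero z z).const_add (∑' y, l y)) ht
  exact ⟨⟨l, (le_antisymm hle hge) ▸ ENNReal.summable.hasSum⟩, fun x y => hl y x⟩

namespace IsLimitLaw

variable {π : PMF S}

theorem mean_le (hπ : IsLimitLaw P π) {f : S → ℝ≥0∞} (hf : ∀ y, f y ≠ ∞) {x : S}
    {B : ℕ → ℝ≥0∞} {c : ℝ≥0∞} (hB : ∀ t, mean (step P t x) f ≤ B t)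
    (hc : Tendsto B atTop (𝓝 c)) : mean π f ≤ c := by
  rw [mean, ENNReal.tsum_eq_iSup_sum]
  refine iSup_le fun F => ?_
  have hF : Tendsto (fun t => ∑ y ∈ F, step P t x y * f y) atTop (𝓝 (∑ y ∈ F, π y * f y)) :=
    tendsto_finsetSum _ fun y _ => ENNReal.Tendsto.mul_const (hπ x y) (Or.inr (hf y))
  exact le_of_tendsto_of_tendsto' hF hc fun t => (ENNReal.sum_le_tsum F).trans (hB t)

theorem mean_le_of_drift (hπ : IsLimitLaw P π) {f : S → ℝ≥0} {γ b c : ℝ≥0} (hγ : γ < 1)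
    (hf : GeometricDrift P f γ b) (hc : γ * c + b = c) : mean π (fun y => (f y : ℝ≥0∞)) ≤ c := by
  obtain ⟨x, -⟩ := π.support_nonempty
  refine hπ.mean_le (by simp) (hf.mean_step_le hc · x) ?_
  have h : Tendsto (fun t => (γ : ℝ≥0∞) ^ t * f x) atTop (𝓝 (0 * f x)) :=
    ENNReal.Tendsto.mul_const
      (ENNReal.tendsto_pow_atTop_nhds_zero_of_lt_one (by exact_mod_cast hγ)) (Or.inr (by simp))
  simpa using h.add_const (c : ℝ≥0∞)

theorem stationary (hπ : IsLimitLaw P π) : π.bind P = π := by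
  classical
  obtain ⟨x, -⟩ := π.support_nonempty
  have hle : ∀ y, π.bind P y ≤ π y := fun y => by
    rw [PMF.bind_apply]
    refine hπ.mean_le (x := x) (fun z => (P z).apply_ne_top y)
      (B := fun t => step P (t + 1) x y) (fun t => ?_) ((hπ x y).comp (tendsto_add_atTop_nat 1))
    rw [step_add, PMF.bind_apply]
    simp only [step_one, mean, le_refl]
  refine PMF.ext fun y => ((hle y).eq_or_lt).resolve_right fun hlt => ?_
  have h := ENNReal.tsum_lt_tsum (by rw [PMF.tsum_coe]; simp) hle hlt
  rw [PMF.tsum_coe, PMF.tsum_coe] at h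
  exact lt_irrefl _ h

theorem pos (hπ : IsLimitLaw P π) (hI : Irreducible P) (y : S) : 0 < π y := by
  obtain ⟨z, hz⟩ := π.support_nonempty
  obtain ⟨k, hk⟩ := hI z y
  rw [← step_apply] at hk
  have hle : π z * step P k z y ≤ π y :=
    le_of_tendsto_of_tendsto'
      (ENNReal.Tendsto.mul_const (hπ z z) (Or.inr (PMF.apply_ne_top _ _)))
      ((hπ z y).comp (tendsto_add_atTop_nat k)) fun t => mul_le_step_add P t k z y z
  exact (ENNReal.mul_pos ((π.mem_support_iff z).1 hz) hk.ne').trans_le hle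

end IsLimitLaw

open Classical in
/-- The probability that the chain started at `y` is not at `x` at the times `1, …, k`. -/
noncomputable def avoidProb (P : S → PMF S) (x : S) : ℕ → S → ℝ≥0∞
  | 0, _ => 1
  | k + 1, y => mean (P y) fun z => if z = x then 0 else avoidProb P x k z

theorem avoidProb_le_one (P : S → PMF S) (x : S) (k : ℕ) (y : S) : avoidProb P x k y ≤ 1 := by
  induction k generalizing y with
  | zero => simp [avoidProb]
  | succ k ih =>
    exact mean_le_one _ fun z => by
      split_ifs <;> [exact zero_le_one; exact ih z]

theorem firstPassage_add_avoidProb (P : S → PMF S) (x : S) (k : ℕ) (y : S) :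
    firstPassage P x (k + 1) y + avoidProb P x (k + 1) y = avoidProb P x k y := by
  classical
  induction k generalizing y with
  | zero =>
    rw [firstPassage, ← mean_ite_eq (P y) x, avoidProb, avoidProb, ← mean_add, ← mean_const (P y) 1]
    exact congrArg _ (funext fun z => by split_ifs <;> simp [avoidProb])
  | succ k ih =>
    rw [firstPassage, avoidProb, avoidProb, mean, mean, ← ENNReal.tsum_add]
    refine tsum_congr fun z => ?_
    split_ifs with h
    · simp
    · rw [← mul_add, ih]

/-- The summands are the probabilities that the last visit to `x` up to time `t` is at time `j`. -/
theorem sum_step_mul_avoidProb_le (P : S → PMF S) (x : S) (t : ℕ) :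
    ∑ j ∈ Finset.range (t + 1), step P j x x * avoidProb P x (t - j) x ≤ 1 := by
  classical
  let visited (t : ℕ) (y : S) : ℝ≥0∞ :=
    ∑ j ∈ Finset.range (t + 1), step P j y x * avoidProb P x (t - j) x
  suffices h : ∀ y, visited t y + (if y = x then 0 else avoidProb P x t y) ≤ 1 from
    le_self_add.trans (h x)
  induction t with
  | zero =>
    intro y
    by_cases h : y = x <;> simp [visited, step, avoidProb, h, Ne.symm]
  | succ t ih =>
    intro y
    have hlater : ∑ j ∈ Finset.range (t + 1), step P (j + 1) y x * avoidProb P x (t - j) x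
        = mean (P y) (visited t) := by
      rw [mean_finsetSum]
      refine Finset.sum_congr rfl fun j _ => ?_
      simp only [step, PMF.bind_apply, mean, ← ENNReal.tsum_mul_right, mul_assoc]
    have hnow : step P 0 y x * avoidProb P x (t + 1) x
        + (if y = x then 0 else avoidProb P x (t + 1) y) = avoidProb P x (t + 1) y := by
      by_cases h : y = x <;> simp [step, h, Ne.symm]
    calc visited (t + 1) y + (if y = x then 0 else avoidProb P x (t + 1) y)
        = mean (P y) (visited t) + avoidProb P x (t + 1) y := by
          simp only [visited, Finset.sum_range_succ' _ (t + 1), Nat.add_sub_add_right, tsub_zero,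
            hlater, add_assoc, hnow]
      _ = mean (P y) fun z => visited t z + if z = x then 0 else avoidProb P x t z := by
          rw [mean_add, avoidProb]
      _ ≤ 1 := mean_le_one _ ih

theorem sum_firstPassage_add_avoidProb (P : S → PMF S) (x y : S) (k : ℕ) :
    ∑ j ∈ Finset.range (k + 1), firstPassage P x j y + avoidProb P x k y = 1 := by
  induction k with
  | zero => simp [firstPassage, avoidProb]
  | succ k ih =>
    rw [Finset.sum_range_succ, add_assoc, firstPassage_add_avoidProb, ih]

/-- Summation by parts: the tails of the passage time sum to its mean. -/
theorem sum_mul_firstPassage_add (P : S → PMF S) (x y : S) (k : ℕ) :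
    ∑ j ∈ Finset.range (k + 1), (j : ℝ≥0∞) * firstPassage P x j y + k * avoidProb P x k y
      = ∑ j ∈ Finset.range k, avoidProb P x j y := by
  induction k with
  | zero => simp
  | succ k ih =>
    rw [Finset.sum_range_succ, Finset.sum_range_succ (avoidProb P x · y), ← ih, add_assoc,
      ← mul_add, firstPassage_add_avoidProb]
    push_cast
    ring

namespace IsLimitLaw

variable {π : PMF S}

theorem tsum_avoidProb_le_inv (hπ : IsLimitLaw P π) (x : S) :
    ∑' j, avoidProb P x j x ≤ (π x)⁻¹ := by
  rw [ENNReal.tsum_eq_iSup_nat]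
  refine iSup_le fun N => ?_
  have hpartial : ∀ t,
      ∑ j ∈ Finset.range N, step P (t + (N - j)) x x * avoidProb P x j x ≤ 1 := fun t => by
    refine le_trans ?_ (sum_step_mul_avoidProb_le P x (t + N))
    rw [← Finset.sum_range_reflect (n := t + N + 1)]
    refine (Finset.sum_le_sum fun j hj => ?_).trans
      (Finset.sum_le_sum_of_subset (Finset.range_subset_range.2 (by omega : N ≤ t + N + 1)))
    have hjN : j < N := Finset.mem_range.1 hj
    rw [show t + N + 1 - 1 - j = t + (N - j) by omega, show t + N - (t + (N - j)) = j by omega]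
  have hlim : Tendsto
      (fun t => ∑ j ∈ Finset.range N, step P (t + (N - j)) x x * avoidProb P x j x)
      atTop (𝓝 (∑ j ∈ Finset.range N, π x * avoidProb P x j x)) :=
    tendsto_finsetSum _ fun j _ => ENNReal.Tendsto.mul_const
      ((hπ x x).comp (tendsto_add_atTop_nat (N - j)))
      (Or.inr (ne_top_of_le_ne_top ENNReal.one_ne_top (avoidProb_le_one P x j x)))
  have hle := le_of_tendsto' hlim hpartial
  rw [← Finset.mul_sum, mul_comm] at hle
  exact ENNReal.le_inv_iff_mul_le.2 hle

theorem positiveRecurrent (hπ : IsLimitLaw P π) (hpos : ∀ y, 0 < π y) : PositiveRecurrent P := by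
  intro x
  have htails : ∑' j, avoidProb P x j x ≠ ∞ :=
    ne_top_of_le_ne_top (ENNReal.inv_ne_top.2 (hpos x).ne') (hπ.tsum_avoidProb_le_inv x)
  constructor
  · have h := ((ENNReal.tendsto_nat_tsum (firstPassage P x · x)).comp
      (tendsto_add_atTop_nat 1)).add (ENNReal.tendsto_atTop_zero_of_tsum_ne_top htails)
    rw [add_zero] at h
    refine tendsto_nhds_unique h (tendsto_const_nhds.congr fun k => ?_)
    exact (sum_firstPassage_add_avoidProb P x x k).symm
  · refine lt_of_le_of_lt ?_ htails.lt_top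
    rw [ENNReal.tsum_eq_iSup_nat]
    refine iSup_le fun k => ?_
    calc _ ≤ ∑ j ∈ Finset.range (k + 1), (j : ℝ≥0∞) * firstPassage P x j x :=
          Finset.sum_le_sum_of_subset (Finset.range_subset_range.2 k.le_succ)
      _ ≤ _ := le_self_add
      _ = _ := sum_mul_firstPassage_add P x x k
      _ ≤ _ := ENNReal.sum_le_tsum _

end IsLimitLaw

end Recurrence

/-! ### The cone of state-space collapse and its span -/

section Geometry

variable {n : ℕ}

theorem inner_eq_sum (x y : RealMatrix n) : inner ℝ x y = ∑ i, ∑ j, x (i, j) * y (i, j) := by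
  rw [PiLp.inner_apply, Fintype.sum_prod_type]
  simp [mul_comm]

theorem norm_sq_eq_sum (x : RealMatrix n) : ‖x‖ ^ 2 = ∑ i, ∑ j, x (i, j) ^ 2 := by
  rw [← real_inner_self_eq_norm_sq, inner_eq_sum]
  simp only [sq]

theorem add_smul_mem_cone {x y : RealMatrix n} (hx : x ∈ cone n) (hy : y ∈ cone n) {t : ℝ}
    (ht : 0 ≤ t) : x + t • y ∈ cone n :=
  ⟨Submodule.add_mem _ hx.1 (Submodule.smul_mem _ _ hy.1), fun p => by
    simpa using add_nonneg (hx.2 p) (mul_nonneg ht (hy.2 p))⟩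

theorem convex_cone (n : ℕ) : Convex ℝ (cone n) := fun x hx y hy a b ha hb _ => by
  have h := add_smul_mem_cone (add_smul_mem_cone (zero_mem_cone n) hx ha) hy hb
  rwa [zero_add] at h

theorem projCone_mem (x : RealMatrix n) : projCone x ∈ cone n := (exists_nearest x).choose_spec.1

theorem norm_perpCone_le (x : RealMatrix n) {y : RealMatrix n} (hy : y ∈ cone n) :
    ‖perpCone x‖ ≤ ‖x - y‖ :=
  (exists_nearest x).choose_spec.2 y hy

theorem projCone_add_perpCone (x : RealMatrix n) : projCone x + perpCone x = x := by
  simp [perpCone]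

theorem inner_perpCone_sub_nonpos (x : RealMatrix n) {y : RealMatrix n} (hy : y ∈ cone n) :
    inner ℝ (perpCone x) (y - projCone x) ≤ 0 := by
  refine (norm_eq_iInf_iff_real_inner_le_zero (convex_cone n) (projCone_mem x)).1 ?_ y hy
  have : Nonempty (cone n) := ⟨0, zero_mem_cone n⟩
  refine le_antisymm (le_ciInf fun w => norm_perpCone_le x w.2) ?_
  exact ciInf_le ⟨0, Set.forall_mem_range.2 fun _ => norm_nonneg _⟩
    (⟨projCone x, projCone_mem x⟩ : cone n)

theorem inner_perpCone_nonpos (x : RealMatrix n) {y : RealMatrix n} (hy : y ∈ cone n) :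
    inner ℝ (perpCone x) y ≤ 0 := by
  have h := inner_perpCone_sub_nonpos x (add_smul_mem_cone (projCone_mem x) hy zero_le_one)
  rwa [one_smul, add_sub_cancel_left] at h

theorem inner_perpCone_projCone (x : RealMatrix n) : inner ℝ (perpCone x) (projCone x) = 0 := by
  refine le_antisymm (inner_perpCone_nonpos x (projCone_mem x)) ?_
  have h := inner_perpCone_sub_nonpos x (zero_mem_cone n)
  rwa [zero_sub, inner_neg_right, neg_nonpos] at h

theorem norm_sq_eq_projCone_add_perpCone (x : RealMatrix n) :
    ‖x‖ ^ 2 = ‖projCone x‖ ^ 2 + ‖perpCone x‖ ^ 2 := by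
  conv_lhs => rw [← projCone_add_perpCone x]
  rw [norm_add_sq_real, real_inner_comm, inner_perpCone_projCone]
  ring

theorem inner_perpCone_self (x : RealMatrix n) : inner ℝ (perpCone x) x = ‖perpCone x‖ ^ 2 := by
  conv_lhs => rw [← projCone_add_perpCone x, inner_add_right, projCone_add_perpCone x]
  rw [inner_perpCone_projCone, real_inner_self_eq_norm_sq, zero_add]

theorem inner_projCone_self (x : RealMatrix n) : inner ℝ (projCone x) x = ‖projCone x‖ ^ 2 := by
  conv_lhs => rw [← projCone_add_perpCone x, inner_add_right, projCone_add_perpCone x]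
  rw [real_inner_comm (perpCone x), inner_perpCone_projCone, real_inner_self_eq_norm_sq, add_zero]

theorem abs_norm_perpCone_sub_le (x y : RealMatrix n) :
    |‖perpCone x‖ - ‖perpCone y‖| ≤ ‖x - y‖ := by
  have h : ∀ x y : RealMatrix n, ‖perpCone x‖ ≤ ‖x - y‖ + ‖perpCone y‖ := fun x y =>
    calc ‖perpCone x‖ ≤ ‖x - projCone y‖ := norm_perpCone_le x (projCone_mem y)
      _ = ‖(x - y) + perpCone y‖ := by simp [perpCone]
      _ ≤ ‖x - y‖ + ‖perpCone y‖ := norm_add_le _ _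
  have hyx := h y x
  rw [norm_sub_rev] at hyx
  exact abs_le.2 ⟨by linarith, by linarith [h x y]⟩

/-- Convexity of `‖projCone ·‖²`, whose gradient at `x` is `2 projCone x`. -/
theorem two_mul_inner_projCone_le (x y : RealMatrix n) :
    2 * inner ℝ (projCone x) (y - x) ≤ ‖projCone y‖ ^ 2 - ‖projCone x‖ ^ 2 := by
  have hperp := inner_perpCone_nonpos y (projCone_mem x)
  have hsq := norm_sub_sq_real (projCone x) (projCone y)
  have hy : inner ℝ (projCone x) y
      = inner ℝ (projCone x) (projCone y) + inner ℝ (perpCone y) (projCone x) := by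
    rw [real_inner_comm (projCone x) (perpCone y), ← inner_add_right, projCone_add_perpCone]
  rw [inner_sub_right, inner_projCone_self, hy]
  linarith [sq_nonneg ‖projCone x - projCone y‖]

theorem rowOnes_mem_cone (i : Fin n) : rowOnes i ∈ cone n :=
  ⟨Submodule.subset_span (Or.inl ⟨i, rfl⟩), fun p => by simp only [rowOnes]; split_ifs <;> simp⟩

theorem colOnes_mem_cone (j : Fin n) : colOnes j ∈ cone n :=
  ⟨Submodule.subset_span (Or.inr ⟨j, rfl⟩), fun p => by simp only [colOnes]; split_ifs <;> simp⟩

theorem inner_rowOnes (x : RealMatrix n) (i : Fin n) : inner ℝ x (rowOnes i) = ∑ j, x (i, j) := by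
  rw [inner_eq_sum]
  simp [rowOnes]

theorem inner_colOnes (x : RealMatrix n) (j : Fin n) : inner ℝ x (colOnes j) = ∑ i, x (i, j) := by
  rw [inner_eq_sum]
  simp [colOnes]

theorem mem_collapseSpace_orthogonal {x : RealMatrix n} (hrow : ∀ i, ∑ j, x (i, j) = 0)
    (hcol : ∀ j, ∑ i, x (i, j) = 0) : x ∈ (collapseSpace n)ᗮ := by
  rw [collapseSpace, Submodule.mem_orthogonal']
  intro y hy
  induction hy using Submodule.span_induction with
  | mem y hy =>
    rcases hy with ⟨i, rfl⟩ | ⟨j, rfl⟩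
    · rw [inner_rowOnes, hrow]
    · rw [inner_colOnes, hcol]
  | zero => simp
  | add y z _ _ hy hz => rw [inner_add_right, hy, hz, add_zero]
  | smul c y _ hy => rw [inner_smul_right, hy, mul_zero]

/-- A real matrix, seen in `ℝ^{n × n}`. -/
noncomputable def ofMatrix (A : Matrix (Fin n) (Fin n) ℝ) : RealMatrix n :=
  WithLp.toLp 2 fun p => A p.1 p.2

@[simp]
theorem ofMatrix_apply (A : Matrix (Fin n) (Fin n) ℝ) (i j : Fin n) :
    ofMatrix A (i, j) = A i j := rfl

@[simp]
theorem toReal_apply (q : PacketMatrix n) (p : Fin n × Fin n) : toReal q p = (q p.1 p.2 : ℝ) := rfl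

theorem weight_eq_inner (q s : PacketMatrix n) :
    (weight q s : ℝ) = inner ℝ (toReal q) (toReal s) := by
  simp [weight, inner_eq_sum]

theorem sum_row_of_mem_schedules {s : PacketMatrix n} (hs : s ∈ schedules n) (i : Fin n) :
    ∑ j, (s i j : ℝ) = 1 := by
  obtain ⟨σ, rfl⟩ := hs
  simp [scheduleOf]

theorem sum_col_of_mem_schedules {s : PacketMatrix n} (hs : s ∈ schedules n) (j : Fin n) :
    ∑ i, (s i j : ℝ) = 1 := by
  obtain ⟨σ, rfl⟩ := hs
  simp only [scheduleOf, ← Equiv.eq_symm_apply]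
  simp

theorem le_one_of_mem_schedules {s : PacketMatrix n} (hs : s ∈ schedules n) (i j : Fin n) :
    s i j ≤ 1 := by
  obtain ⟨σ, rfl⟩ := hs
  simp only [scheduleOf]
  split_ifs <;> simp

theorem inner_le_maxWeight (q : PacketMatrix n) {A : Matrix (Fin n) (Fin n) ℝ}
    (hA : A ∈ doublyStochastic ℝ (Fin n)) : inner ℝ (toReal q) (ofMatrix A) ≤ maxWeight q := by
  obtain ⟨w, hw0, hw1, rfl⟩ := exists_eq_sum_perm_of_mem_doublyStochastic hA
  have hsum : ofMatrix (∑ σ, w σ • σ.permMatrix ℝ) = ∑ σ, w σ • toReal (scheduleOf σ) := by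
    ext ⟨i, j⟩
    simp [Matrix.sum_apply, scheduleOf, Equiv.Perm.permMatrix, PEquiv.toMatrix_apply, eq_comm]
  calc inner ℝ (toReal q) (ofMatrix (∑ σ, w σ • σ.permMatrix ℝ))
      = ∑ σ, w σ * (weight q (scheduleOf σ) : ℝ) := by
        simp only [hsum, inner_sum, inner_smul_right, weight_eq_inner]
    _ ≤ ∑ σ, w σ * (maxWeight q : ℝ) := by
        refine Finset.sum_le_sum fun σ _ => mul_le_mul_of_nonneg_left ?_ (hw0 σ)
        exact_mod_cast Finset.le_sup (f := fun σ => weight q (scheduleOf σ)) (Finset.mem_univ σ)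
    _ = maxWeight q := by rw [← Finset.sum_mul, hw1, one_mul]

/-- The deficits `r i` and `c j` of the row and column sums have the same total `T`, so that adding
`r i * c j / T` fills them. -/
theorem exists_doublyStochastic_ge {ι : Type*} [Fintype ι] [DecidableEq ι] {A : Matrix ι ι ℝ}
    (h0 : ∀ i j, 0 ≤ A i j) (hrow : ∀ i, ∑ j, A i j ≤ 1) (hcol : ∀ j, ∑ i, A i j ≤ 1) :
    ∃ B ∈ doublyStochastic ℝ ι, ∀ i j, A i j ≤ B i j := by
  let r (i : ι) : ℝ := 1 - ∑ j, A i j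
  let c (j : ι) : ℝ := 1 - ∑ i, A i j
  have hr : ∀ i, 0 ≤ r i := fun i => sub_nonneg.2 (hrow i)
  have hc : ∀ j, 0 ≤ c j := fun j => sub_nonneg.2 (hcol j)
  have htotal : ∑ i, r i = ∑ j, c j := by
    simp only [r, c, Finset.sum_sub_distrib]
    rw [Finset.sum_comm]
  have hr_total : ∀ i, r i * (∑ j, c j) / ∑ j, c j = r i := fun i =>
    mul_div_cancel_of_imp fun h =>
      (Finset.sum_eq_zero_iff_of_nonneg fun i _ => hr i).1 (htotal.trans h) i (Finset.mem_univ i)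
  have hc_total : ∀ j, c j * (∑ j, c j) / ∑ j, c j = c j := fun j =>
    mul_div_cancel_of_imp fun h =>
      (Finset.sum_eq_zero_iff_of_nonneg fun j _ => hc j).1 h j (Finset.mem_univ j)
  have hfill : ∀ i j, 0 ≤ r i * c j / ∑ j, c j := fun i j =>
    div_nonneg (mul_nonneg (hr i) (hc j)) (Finset.sum_nonneg fun j _ => hc j)
  refine ⟨fun i j => A i j + r i * c j / ∑ j, c j, mem_doublyStochastic_iff_sum.2
    ⟨fun i j => add_nonneg (h0 i j) (hfill i j), fun i => ?_, fun j => ?_⟩,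
    fun i j => le_add_of_nonneg_right (hfill i j)⟩
  · rw [Finset.sum_add_distrib, ← Finset.sum_div, ← Finset.mul_sum, hr_total, add_sub_cancel]
  · rw [Finset.sum_add_distrib, ← Finset.sum_div, ← Finset.sum_mul, mul_comm, htotal, hc_total,
      add_sub_cancel]

/-- Moving from `ν` in the direction of `q_⊥` does not increase row and column sums, and stays
nonnegative for a distance `δ`. -/
theorem inner_add_mul_norm_perpCone_le_maxWeight (q : PacketMatrix n)
    {ν : Matrix (Fin n) (Fin n) ℝ} (hν : ν ∈ doublyStochastic ℝ (Fin n)) {δ : ℝ} (hδ : 0 ≤ δ)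
    (hδν : ∀ i j, δ ≤ ν i j) :
    inner ℝ (toReal q) (ofMatrix ν) + δ * ‖perpCone (toReal q)‖ ≤ maxWeight q := by
  set z := perpCone (toReal q) with hz
  let A : Matrix (Fin n) (Fin n) ℝ := fun i j => ν i j + δ / ‖z‖ * z (i, j)
  have hcoef : 0 ≤ δ / ‖z‖ := by positivity
  have hA0 : ∀ i j, 0 ≤ A i j := fun i j => by
    have hzij : δ / ‖z‖ * -z (i, j) ≤ δ :=
      calc δ / ‖z‖ * -z (i, j) ≤ δ / ‖z‖ * ‖z‖ := by
            gcongr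
            exact (neg_le_abs _).trans (by simpa using PiLp.norm_apply_le z (i, j))
        _ = δ * (‖z‖ / ‖z‖) := by ring
        _ ≤ δ := mul_le_of_le_one_right hδ (div_self_le_one _)
    simp only [A]
    linarith [hδν i j]
  have hrow : ∀ i, ∑ j, A i j ≤ 1 := fun i => by
    have hzi := inner_perpCone_nonpos (toReal q) (rowOnes_mem_cone i)
    rw [inner_rowOnes] at hzi
    simp only [A, Finset.sum_add_distrib, ← Finset.mul_sum, sum_row_of_mem_doublyStochastic hν]
    linarith [mul_nonpos_of_nonneg_of_nonpos hcoef hzi]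
  have hcol : ∀ j, ∑ i, A i j ≤ 1 := fun j => by
    have hzj := inner_perpCone_nonpos (toReal q) (colOnes_mem_cone j)
    rw [inner_colOnes] at hzj
    simp only [A, Finset.sum_add_distrib, ← Finset.mul_sum, sum_col_of_mem_doublyStochastic hν]
    linarith [mul_nonpos_of_nonneg_of_nonpos hcoef hzj]
  obtain ⟨B, hB, hAB⟩ := exists_doublyStochastic_ge hA0 hrow hcol
  have hA : ofMatrix A = ofMatrix ν + (δ / ‖z‖) • z := by
    ext ⟨i, j⟩; rfl
  calc inner ℝ (toReal q) (ofMatrix ν) + δ * ‖z‖ = inner ℝ (toReal q) (ofMatrix A) := by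
        rw [hA, inner_add_right, inner_smul_right, real_inner_comm z, inner_perpCone_self, ← hz]
        field_simp
    _ ≤ inner ℝ (toReal q) (ofMatrix B) := by
        simp only [inner_eq_sum, ofMatrix_apply, toReal_apply]
        gcongr with i _ j _
        exact hAB i j
    _ ≤ maxWeight q := inner_le_maxWeight q hB

/-- The orthogonal projection onto the collapse space. -/
noncomputable abbrev projSpace (n : ℕ) : RealMatrix n →L[ℝ] RealMatrix n :=
  (collapseSpace n).starProjection

/-- The doubly stochastic matrix with equal entries: the common projection of all doubly stochastic
matrices onto the collapse space. -/
noncomputable def uniformMatrix (n : ℕ) : RealMatrix n := WithLp.toLp 2 fun _ => 1 / (n : ℝ)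

theorem uniformMatrix_mem (n : ℕ) : uniformMatrix n ∈ collapseSpace n := by
  have h : uniformMatrix n = (1 / (n : ℝ)) • ∑ i, rowOnes i := by
    ext ⟨i, j⟩
    simp [uniformMatrix, rowOnes]
  rw [h]
  exact Submodule.smul_mem _ _ (Submodule.sum_mem _ fun i _ => (rowOnes_mem_cone i).1)

theorem projSpace_uniformMatrix (n : ℕ) : projSpace n (uniformMatrix n) = uniformMatrix n :=
  Submodule.starProjection_eq_self_iff.2 (uniformMatrix_mem n)

theorem projSpace_eq_uniformMatrix (hn : 0 < n) {x : RealMatrix n}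
    (hrow : ∀ i, ∑ j, x (i, j) = 1) (hcol : ∀ j, ∑ i, x (i, j) = 1) :
    projSpace n x = uniformMatrix n := by
  have hn' : (n : ℝ) ≠ 0 := by positivity
  refine Submodule.eq_starProjection_of_mem_orthogonal (uniformMatrix_mem n) ?_
  exact mem_collapseSpace_orthogonal (fun i => by simp [uniformMatrix, hrow, hn'])
    fun j => by simp [uniformMatrix, hcol, hn']

theorem inner_uniformMatrix (x : RealMatrix n) :
    inner ℝ x (uniformMatrix n) = (∑ i, ∑ j, x (i, j)) / n := by
  rw [inner_eq_sum]
  simp [uniformMatrix, div_eq_mul_inv, Finset.sum_mul]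

theorem norm_sq_uniformMatrix (hn : 0 < n) : ‖uniformMatrix n‖ ^ 2 = 1 := by
  have hn' : (n : ℝ) ≠ 0 := by positivity
  rw [norm_sq_eq_sum]
  simp [uniformMatrix]
  field_simp

theorem inner_projSpace_left (x y : RealMatrix n) :
    inner ℝ (projSpace n x) y = inner ℝ x (projSpace n y) :=
  Submodule.inner_starProjection_left_eq_right _ _ _

theorem inner_projSpace_projSpace (x y : RealMatrix n) :
    inner ℝ (projSpace n x) (projSpace n y) = inner ℝ (projSpace n x) y := by
  rw [← inner_projSpace_left, Submodule.starProjection_eq_self_iff.2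
    (Submodule.starProjection_apply_mem _ _)]

theorem norm_projSpace_le (x : RealMatrix n) : ‖projSpace n x‖ ≤ ‖x‖ :=
  Submodule.norm_starProjection_apply_le _ _

theorem norm_sub_projSpace_le (x : RealMatrix n) : ‖x - projSpace n x‖ ≤ ‖perpCone x‖ := by
  have hcone : projSpace n (projCone x) = projCone x :=
    Submodule.starProjection_eq_self_iff.2 (projCone_mem x).1
  have hperp : x - projSpace n x = (collapseSpace n)ᗮ.starProjection (perpCone x) := by
    rw [Submodule.starProjection_orthogonal_val, perpCone, map_sub, hcone]
    abel
  rw [hperp]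
  exact Submodule.norm_starProjection_apply_le _ _

theorem projSpace_single (hn : 0 < n) (k l : Fin n) :
    projSpace n (EuclideanSpace.single (k, l) 1)
      = (1 / (n : ℝ)) • (rowOnes k + colOnes l - uniformMatrix n) := by
  have hn' : (n : ℝ) ≠ 0 := by positivity
  refine Submodule.eq_starProjection_of_mem_orthogonal ?_
    (mem_collapseSpace_orthogonal (fun i => ?_) fun j => ?_)
  · exact Submodule.smul_mem _ _ (Submodule.sub_mem _ (Submodule.add_mem _
      (rowOnes_mem_cone k).1 (colOnes_mem_cone l).1) (uniformMatrix_mem n))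
  · by_cases h : i = k <;>
      simp [rowOnes, colOnes, uniformMatrix, h, Finset.sum_sub_distrib, Finset.sum_add_distrib,
        ← Finset.mul_sum, hn']
  · by_cases h : j = l <;>
      simp [rowOnes, colOnes, uniformMatrix, h, Finset.sum_sub_distrib, Finset.sum_add_distrib,
        ← Finset.mul_sum, hn']

theorem norm_sq_projSpace_single (hn : 0 < n) (p : Fin n × Fin n) :
    ‖projSpace n (EuclideanSpace.single p 1)‖ ^ 2 = (2 * n - 1) / (n : ℝ) ^ 2 := by
  have hn' : (n : ℝ) ≠ 0 := by positivity
  rw [← real_inner_self_eq_norm_sq, inner_projSpace_projSpace, projSpace_single hn,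
    EuclideanSpace.inner_single_right]
  simp [rowOnes, colOnes, uniformMatrix]
  field_simp
  ring

end Geometry

/-! ### From a drift of the second moment to a drift of an exponential moment -/

section ExponentialDrift

theorem exp_mul_le_of_abs_sub_le {θ D v z : ℝ} (hθ : 0 ≤ θ) (hθD : θ * D ≤ 1)
    (hz : |z - v| ≤ D) :
    Real.exp (θ * z) ≤ Real.exp (θ * v) * (1 + θ ^ 2 * D ^ 2 + θ * (z - v)) := by
  have hle : |θ * (z - v)| ≤ θ * D := by
    rw [abs_mul, abs_of_nonneg hθ]
    exact mul_le_mul_of_nonneg_left hz hθ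
  have hsq : (θ * (z - v)) ^ 2 ≤ θ ^ 2 * D ^ 2 := by
    rw [← mul_pow, ← sq_abs (θ * (z - v))]
    exact pow_le_pow_left₀ (abs_nonneg _) hle 2
  rw [show θ * z = θ * v + θ * (z - v) by ring, Real.exp_add]
  gcongr
  linarith [(abs_le.1 (Real.abs_exp_sub_one_sub_id_le (hle.trans hθD))).2]

variable {Ω : Type*} [MeasurableSpace Ω] {κ : Measure Ω} [IsProbabilityMeasure κ] {Z : Ω → ℝ}
  {θ D δ c v : ℝ}

theorem integrable_sub_const_of_abs_sub_le (hZ : Measurable Z) (hD : ∀ᵐ ω ∂κ, |Z ω - v| ≤ D) :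
    Integrable (fun ω => Z ω - v) κ :=
  .of_bound (hZ.sub_const v).aestronglyMeasurable D hD

theorem integrable_sq_of_abs_sub_le (hZ : Measurable Z) (hD : ∀ᵐ ω ∂κ, |Z ω - v| ≤ D) :
    Integrable (fun ω => Z ω ^ 2) κ := by
  refine .of_bound (hZ.pow_const 2).aestronglyMeasurable ((|v| + D) ^ 2) ?_
  filter_upwards [hD] with ω hω
  rw [norm_pow, Real.norm_eq_abs]
  have : |Z ω| ≤ |v| + |Z ω - v| := by simpa using abs_add_le v (Z ω - v)
  gcongr
  linarith

theorem integral_const_add_const_mul {f : Ω → ℝ} (hf : Integrable f κ) (a k : ℝ) :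
    ∫ ω, (a + k * f ω) ∂κ = a + k * ∫ ω, f ω ∂κ := by
  rw [integral_add (integrable_const a) (hf.const_mul k), integral_const_mul]
  simp

theorem integral_sub_le_of_integral_sq_le (hZ : Measurable Z) (hD : ∀ᵐ ω ∂κ, |Z ω - v| ≤ D)
    (hv : 0 < v) (hc : c ≤ δ * v / 2) (hdrift : ∫ ω, Z ω ^ 2 ∂κ ≤ v ^ 2 - δ * v + c) :
    ∫ ω, (Z ω - v) ∂κ ≤ -(δ / 4) := by
  have hΔ := integrable_sub_const_of_abs_sub_le hZ hD
  have htangent : ∫ ω, (v ^ 2 + 2 * v * (Z ω - v)) ∂κ ≤ ∫ ω, Z ω ^ 2 ∂κ :=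
    integral_mono ((integrable_const _).add (hΔ.const_mul _)) (integrable_sq_of_abs_sub_le hZ hD)
      fun ω => by nlinarith [sq_nonneg (Z ω - v)]
  rw [integral_const_add_const_mul hΔ] at htangent
  have : v * (2 * ∫ ω, (Z ω - v) ∂κ) ≤ v * (-(δ / 2)) := by linarith
  linarith [le_of_mul_le_mul_left this hv]

theorem lintegral_exp_mul_le_of_integral_sub_le (hZ : Measurable Z)
    (hD : ∀ᵐ ω ∂κ, |Z ω - v| ≤ D) (hθ : 0 ≤ θ) (hθD : θ * D ≤ 1) (hθδ : θ * D ^ 2 ≤ δ / 8)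
    (hmean : ∫ ω, (Z ω - v) ∂κ ≤ -(δ / 4)) :
    ∫⁻ ω, ENNReal.ofReal (Real.exp (θ * Z ω)) ∂κ
      ≤ ENNReal.ofReal (Real.exp (θ * v) * (1 - θ * δ / 8)) := by
  have hΔ := integrable_sub_const_of_abs_sub_le hZ hD
  have hexp : ∀ᵐ ω ∂κ, Real.exp (θ * Z ω)
      ≤ Real.exp (θ * v) * (1 + θ ^ 2 * D ^ 2 + θ * (Z ω - v)) :=
    hD.mono fun ω => exp_mul_le_of_abs_sub_le hθ hθD
  have hint : Integrable
      (fun ω => Real.exp (θ * v) * (1 + θ ^ 2 * D ^ 2 + θ * (Z ω - v))) κ :=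
    ((integrable_const _).add (hΔ.const_mul _)).const_mul _
  have hintexp : Integrable (fun ω => Real.exp (θ * Z ω)) κ :=
    hint.mono' (by fun_prop) (by simpa only [Real.norm_eq_abs, Real.abs_exp] using hexp)
  rw [← ofReal_integral_eq_lintegral_ofReal hintexp (ae_of_all _ fun ω => (Real.exp_pos _).le)]
  apply ENNReal.ofReal_le_ofReal
  calc ∫ ω, Real.exp (θ * Z ω) ∂κ
      ≤ ∫ ω, Real.exp (θ * v) * (1 + θ ^ 2 * D ^ 2 + θ * (Z ω - v)) ∂κ :=
        integral_mono_ae hintexp hint hexp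
    _ = Real.exp (θ * v) * (1 + θ ^ 2 * D ^ 2 + θ * ∫ ω, (Z ω - v) ∂κ) := by
        rw [integral_const_mul, integral_const_add_const_mul hΔ]
    _ ≤ Real.exp (θ * v) * (1 - θ * δ / 8) := by
        gcongr
        nlinarith

theorem lintegral_exp_mul_le_of_le {B : ℝ} (hD : ∀ᵐ ω ∂κ, |Z ω - v| ≤ D) (hθ : 0 ≤ θ)
    (hv : v ≤ B) :
    ∫⁻ ω, ENNReal.ofReal (Real.exp (θ * Z ω)) ∂κ ≤ ENNReal.ofReal (Real.exp (θ * (B + D))) := by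
  calc ∫⁻ ω, ENNReal.ofReal (Real.exp (θ * Z ω)) ∂κ
      ≤ ∫⁻ _, ENNReal.ofReal (Real.exp (θ * (B + D))) ∂κ := by
        refine lintegral_mono_ae (hD.mono fun ω hω => ?_)
        gcongr
        linarith [(abs_le.1 hω).2]
    _ = ENNReal.ofReal (Real.exp (θ * (B + D))) := by simp

theorem exists_geometricDrift_exp {D δ : ℝ} (hD : 0 < D) (hδ : 0 < δ) (c : ℝ) :
    ∃ θ : ℝ, 0 < θ ∧ ∃ γ b : ℝ≥0, γ < 1 ∧ ∀ {S : Type v} [MeasurableSpace S]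
      [DiscreteMeasurableSpace S] [Countable S] (P : S → PMF S) (N : S → ℝ),
      (∀ x, ∀ᵐ y ∂(P x).toMeasure, |N y - N x| ≤ D) →
      (∀ x, ∫ y, N y ^ 2 ∂(P x).toMeasure ≤ N x ^ 2 - δ * N x + c) →
      GeometricDrift P (fun x => (Real.exp (θ * N x)).toNNReal) γ b := by
  set θ : ℝ := min (1 / D) (min (δ / (8 * D ^ 2)) (1 / δ))
  have hθ : 0 < θ := by positivity
  have hθD : θ * D ≤ 1 := (le_div_iff₀ hD).1 (min_le_left _ _)
  have hθδ : θ * D ^ 2 ≤ δ / 8 := by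
    have : θ * (8 * D ^ 2) ≤ δ :=
      (le_div_iff₀ (by positivity)).1 ((min_le_right _ _).trans (min_le_left _ _))
    linarith
  have hθδ1 : θ * δ ≤ 1 :=
    (le_div_iff₀ hδ).1 ((min_le_right _ _).trans (min_le_right _ _))
  set B : ℝ := 2 * |c| / δ with hB
  have hcB : c ≤ δ * B / 2 := by
    rw [hB, mul_div_cancel₀ _ hδ.ne']
    linarith [le_abs_self c]
  refine ⟨θ, hθ, (1 - θ * δ / 8).toNNReal, (Real.exp (θ * (B + D))).toNNReal, ?_, ?_⟩
  · rw [Real.toNNReal_lt_one]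
    linarith [mul_pos hθ hδ]
  intro S _ _ _ P N hND hdrift x
  rw [mean_eq_lintegral]
  change ∫⁻ y, ENNReal.ofReal _ ∂_ ≤ ENNReal.ofReal _ * ENNReal.ofReal _ + ENNReal.ofReal _
  rcases le_or_gt (N x) B with hx | hx
  · exact (lintegral_exp_mul_le_of_le (hND x) hθ.le hx).trans le_add_self
  · have hmean : ∫ y, (N y - N x) ∂(P x).toMeasure ≤ -(δ / 4) :=
      integral_sub_le_of_integral_sq_le .of_discrete (hND x)
        ((by positivity : 0 ≤ B).trans_lt hx) (hcB.trans (by gcongr)) (hdrift x)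
    rw [← ENNReal.ofReal_mul (by linarith), mul_comm]
    exact (lintegral_exp_mul_le_of_integral_sub_le .of_discrete (hND x) hθ.le hθD hθδ
      hmean).trans le_self_add

end ExponentialDrift

/-! ### One slot of the switch -/

section OneSlot

variable {n : ℕ}

/-- The queue lengths `[q + a - s]⁺` after a slot; the subtraction of `ℕ` is the truncated one that
the model asks for. -/
def nextQueue (q a s : PacketMatrix n) : PacketMatrix n := fun i j => q i j + a i j - s i j

/-- The unused service `[s - (q + a)]⁺` of a slot. -/
def unused (q a s : PacketMatrix n) : PacketMatrix n := fun i j => s i j - (q i j + a i j)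

/-- The total number of packets. -/
noncomputable def total (q : PacketMatrix n) : ℝ := ∑ i, ∑ j, (q i j : ℝ)

theorem toReal_nextQueue (q a s : PacketMatrix n) :
    toReal (nextQueue q a s) = toReal q + (toReal a - toReal s) + toReal (unused q a s) := by
  ext ⟨i, j⟩
  simp only [toReal_apply, nextQueue, unused, PiLp.add_apply, PiLp.sub_apply]
  have : ((q i j + a i j - s i j : ℕ) : ℤ)
      = q i j + (a i j - s i j) + (s i j - (q i j + a i j) : ℕ) := by
    omega
  exact_mod_cast this

theorem inner_nextQueue_unused (q a s : PacketMatrix n) :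
    inner ℝ (toReal (nextQueue q a s)) (toReal (unused q a s)) = 0 := by
  rw [inner_eq_sum]
  refine Finset.sum_eq_zero fun i _ => Finset.sum_eq_zero fun j _ => ?_
  have : nextQueue q a s i j * unused q a s i j = 0 := by
    simp only [nextQueue, unused, mul_eq_zero]
    omega
  simp only [toReal_apply]
  exact_mod_cast this

theorem total_nonneg (q : PacketMatrix n) : 0 ≤ total q := by
  unfold total
  positivity

theorem norm_le_total (q : PacketMatrix n) : ‖toReal q‖ ≤ total q := by
  refine (sq_le_sq₀ (norm_nonneg _) (total_nonneg q)).1 ?_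
  rw [EuclideanSpace.norm_sq_eq, total, ← Fintype.sum_prod_type' fun i j => (q i j : ℝ)]
  simpa using Finset.sum_sq_le_sq_sum_of_nonneg fun (p : Fin n × Fin n) _ =>
    (q p.1 p.2).cast_nonneg (α := ℝ)

theorem norm_sq_unused {q a s : PacketMatrix n} (hs : s ∈ schedules n) :
    ‖toReal (unused q a s)‖ ^ 2 = total (unused q a s) := by
  rw [norm_sq_eq_sum, total]
  refine Finset.sum_congr rfl fun i _ => Finset.sum_congr rfl fun j _ => ?_
  have hle : unused q a s i j ≤ 1 := (Nat.sub_le _ _).trans (le_one_of_mem_schedules hs i j)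
  rw [toReal_apply]
  interval_cases unused q a s i j <;> simp

theorem total_nextQueue (q a : PacketMatrix n) {s : PacketMatrix n} (hs : s ∈ schedules n) :
    total (nextQueue q a s) = total q + total a - n + total (unused q a s) := by
  have hsum : total s = n := by simp [total, sum_row_of_mem_schedules hs]
  rw [← hsum]
  simp only [total, ← Finset.sum_add_distrib, ← Finset.sum_sub_distrib]
  refine Finset.sum_congr rfl fun i _ => Finset.sum_congr rfl fun j _ => ?_
  rw [add_sub_assoc]
  exact congrArg (fun x : RealMatrix n => x (i, j)) (toReal_nextQueue q a s)

theorem norm_le_of_abs_le {x : RealMatrix n} {C : ℝ} (hC : 0 ≤ C) (h : ∀ i j, |x (i, j)| ≤ C) :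
    ‖x‖ ≤ n * C := by
  refine (sq_le_sq₀ (norm_nonneg _) (by positivity)).1 ?_
  calc ‖x‖ ^ 2 = ∑ i, ∑ j, |x (i, j)| ^ 2 := by simp only [norm_sq_eq_sum, sq_abs]
    _ ≤ ∑ _i : Fin n, ∑ _j : Fin n, C ^ 2 := by
        gcongr with i _ j _
        exact h i j
    _ = (n * C) ^ 2 := by simp; ring

variable {amax : ℕ} {a s : PacketMatrix n}

theorem norm_arrival_sub_schedule_le (ha : ∀ i j, a i j ≤ amax) (hs : s ∈ schedules n) :
    ‖toReal a - toReal s‖ ≤ n * (amax + 1 : ℝ) := by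
  refine norm_le_of_abs_le (by positivity) fun i j => ?_
  have hs1 := le_one_of_mem_schedules hs i j
  have : |(a i j : ℤ) - s i j| ≤ amax + 1 := by
    rw [abs_le]
    have := ha i j
    omega
  simp only [PiLp.sub_apply, toReal_apply]
  exact_mod_cast this

theorem norm_nextQueue_sub_le (q : PacketMatrix n) (ha : ∀ i j, a i j ≤ amax)
    (hs : s ∈ schedules n) : ‖toReal (nextQueue q a s) - toReal q‖ ≤ n * (amax + 1 : ℝ) := by
  refine norm_le_of_abs_le (by positivity) fun i j => ?_
  have hs1 := le_one_of_mem_schedules hs i j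
  have : |((nextQueue q a s i j : ℕ) : ℤ) - q i j| ≤ amax + 1 := by
    simp only [nextQueue]
    rw [abs_le]
    have := ha i j
    omega
  simp only [PiLp.sub_apply, toReal_apply]
  exact_mod_cast this

theorem norm_sq_nextQueue_le (q : PacketMatrix n) (ha : ∀ i j, a i j ≤ amax)
    (hs : s ∈ schedules n) :
    ‖toReal (nextQueue q a s)‖ ^ 2 ≤ ‖toReal q‖ ^ 2 + (n * (amax + 1 : ℝ)) ^ 2
      + 2 * (inner ℝ (toReal q) (toReal a) - weight q s) := by
  have hsub : toReal (nextQueue q a s) - toReal (unused q a s)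
      = toReal q + (toReal a - toReal s) := by
    rw [toReal_nextQueue, add_sub_cancel_right]
  have hle : ‖toReal (nextQueue q a s)‖ ^ 2 ≤ ‖toReal q + (toReal a - toReal s)‖ ^ 2 := by
    rw [← hsub, norm_sub_sq_real, inner_nextQueue_unused]
    linarith [sq_nonneg ‖toReal (unused q a s)‖]
  have hdiff : ‖toReal a - toReal s‖ ^ 2 ≤ (n * (amax + 1 : ℝ)) ^ 2 :=
    pow_le_pow_left₀ (norm_nonneg _) (norm_arrival_sub_schedule_le ha hs) 2
  rw [norm_add_sq_real, inner_sub_right, ← weight_eq_inner q s] at hle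
  linarith

theorem inner_schedule_eq {x : RealMatrix n} (hx : x ∈ collapseSpace n) (hs : s ∈ schedules n)
    {ν : Matrix (Fin n) (Fin n) ℝ} (hν : ν ∈ doublyStochastic ℝ (Fin n)) :
    inner ℝ x (toReal s) = inner ℝ x (ofMatrix ν) := by
  have horth : toReal s - ofMatrix ν ∈ (collapseSpace n)ᗮ :=
    mem_collapseSpace_orthogonal
      (fun i => by simp [sum_row_of_mem_schedules hs, sum_row_of_mem_doublyStochastic hν])
      (fun j => by simp [sum_col_of_mem_schedules hs, sum_col_of_mem_doublyStochastic hν])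
  rw [← sub_eq_zero, ← inner_sub_right]
  exact (Submodule.mem_orthogonal _ _).1 horth x hx

theorem norm_sq_perpCone_nextQueue_le (q : PacketMatrix n) (ha : ∀ i j, a i j ≤ amax)
    (hs : s ∈ schedules n) {ν : Matrix (Fin n) (Fin n) ℝ} (hν : ν ∈ doublyStochastic ℝ (Fin n)) :
    ‖perpCone (toReal (nextQueue q a s))‖ ^ 2
      ≤ ‖perpCone (toReal q)‖ ^ 2 + (n * (amax + 1 : ℝ)) ^ 2
        + 2 * inner ℝ (projCone (toReal q)) (ofMatrix ν)
        + 2 * (inner ℝ (perpCone (toReal q)) (toReal a) - weight q s) := by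
  have hq := norm_sq_eq_projCone_add_perpCone (toReal q)
  have hnext := norm_sq_eq_projCone_add_perpCone (toReal (nextQueue q a s))
  have hproj := two_mul_inner_projCone_le (toReal q) (toReal (nextQueue q a s))
  have hstep : toReal (nextQueue q a s) - toReal q
      = toReal a - toReal s + toReal (unused q a s) := by
    rw [toReal_nextQueue]
    abel
  have hunused : 0 ≤ inner ℝ (projCone (toReal q)) (toReal (unused q a s)) := by
    rw [inner_eq_sum]
    refine Finset.sum_nonneg fun i _ => Finset.sum_nonneg fun j _ => ?_
    exact mul_nonneg ((projCone_mem _).2 _) (by simp)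
  have harrival : inner ℝ (toReal q) (toReal a)
      = inner ℝ (projCone (toReal q)) (toReal a) + inner ℝ (perpCone (toReal q)) (toReal a) := by
    rw [← inner_add_left, projCone_add_perpCone]
  rw [hstep, inner_add_right, inner_sub_right, inner_schedule_eq (projCone_mem _).1 hs hν] at hproj
  linarith [norm_sq_nextQueue_le q ha hs]

/-- The effect of the unused service on `‖projSpace q‖²`. -/
noncomputable def unusedError (q a s : PacketMatrix n) : ℝ :=
  2 * inner ℝ (toReal (nextQueue q a s) - projSpace n (toReal (nextQueue q a s)))
      (toReal (unused q a s))
    + ‖projSpace n (toReal (unused q a s))‖ ^ 2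

theorem norm_sq_projSpace_nextQueue (hn : 0 < n) (q a : PacketMatrix n) (hs : s ∈ schedules n) :
    ‖projSpace n (toReal (nextQueue q a s))‖ ^ 2
      = ‖projSpace n (toReal q)‖ ^ 2 - 2 * total q / n
        + 2 * inner ℝ (projSpace n (toReal q)) (toReal a)
        + ‖projSpace n (toReal a) - uniformMatrix n‖ ^ 2 - unusedError q a s := by
  have hproj : projSpace n (toReal s) = uniformMatrix n :=
    projSpace_eq_uniformMatrix hn (sum_row_of_mem_schedules hs) (sum_col_of_mem_schedules hs)
  set A := projSpace n (toReal q) + (projSpace n (toReal a) - uniformMatrix n) with hA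
  set U := projSpace n (toReal (unused q a s)) with hU
  have hnext : projSpace n (toReal (nextQueue q a s)) = A + U := by
    rw [toReal_nextQueue, map_add, map_add, map_sub, hproj]
  have hcross : inner ℝ (projSpace n (toReal (nextQueue q a s))) U
      = -inner ℝ (toReal (nextQueue q a s) - projSpace n (toReal (nextQueue q a s)))
          (toReal (unused q a s)) := by
    rw [hU, inner_projSpace_projSpace, inner_sub_left, inner_nextQueue_unused, zero_sub, neg_neg]
  have hdrift : inner ℝ (projSpace n (toReal q)) (projSpace n (toReal a) - uniformMatrix n)
      = inner ℝ (projSpace n (toReal q)) (toReal a) - total q / n := by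
    rw [inner_sub_right, inner_projSpace_projSpace, inner_projSpace_left _ (uniformMatrix n),
      projSpace_uniformMatrix, inner_uniformMatrix]
    rfl
  have hsq : ‖A + U‖ ^ 2 = ‖A‖ ^ 2 + 2 * inner ℝ (A + U) U - ‖U‖ ^ 2 := by
    rw [norm_add_sq_real, inner_add_left A U U, real_inner_self_eq_norm_sq]
    ring
  rw [← hnext, hcross] at hsq
  rw [hsq, hA, norm_add_sq_real, hdrift, unusedError]
  ring

theorem abs_unusedError_le (q a : PacketMatrix n) (hs : s ∈ schedules n) {η : ℝ} (hη : 0 < η) :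
    |unusedError q a s| ≤ η * ‖perpCone (toReal (nextQueue q a s))‖ ^ 2
      + (1 / η + 1) * total (unused q a s) := by
  rw [unusedError, ← norm_sq_unused hs]
  set w := toReal (nextQueue q a s)
  set u := toReal (unused q a s)
  have hinner : |inner ℝ (w - projSpace n w) u| ≤ ‖perpCone w‖ * ‖u‖ :=
    (abs_real_inner_le_norm _ _).trans (by gcongr; exact norm_sub_projSpace_le w)
  have hproj : ‖projSpace n u‖ ^ 2 ≤ ‖u‖ ^ 2 := by gcongr; exact norm_projSpace_le u
  have hyoung : 2 * (‖perpCone w‖ * ‖u‖) ≤ η * ‖perpCone w‖ ^ 2 + 1 / η * ‖u‖ ^ 2 := by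
    have hsq : η * ‖perpCone w‖ ^ 2 + 1 / η * ‖u‖ ^ 2 - 2 * (‖perpCone w‖ * ‖u‖)
        = (η * ‖perpCone w‖ - ‖u‖) ^ 2 / η := by field_simp; ring
    rw [← sub_nonneg, hsq]
    positivity
  calc |2 * inner ℝ (w - projSpace n w) u + ‖projSpace n u‖ ^ 2|
      ≤ 2 * |inner ℝ (w - projSpace n w) u| + ‖projSpace n u‖ ^ 2 := by
        refine (abs_add_le _ _).trans_eq ?_
        rw [abs_mul, abs_two, abs_sq]
    _ ≤ η * ‖perpCone w‖ ^ 2 + (1 / η + 1) * ‖u‖ ^ 2 := by linarith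

end OneSlot

/-! ### Mean drifts over one slot -/

theorem norm_sq_map_eq_sum {ι E : Type*} [Fintype ι] [DecidableEq ι] [NormedAddCommGroup E]
    [InnerProductSpace ℝ E] (T : EuclideanSpace ℝ ι →L[ℝ] E) (x : EuclideanSpace ℝ ι) :
    ‖T x‖ ^ 2 = ∑ p, ∑ p', inner ℝ (T (EuclideanSpace.single p 1))
      (T (EuclideanSpace.single p' 1)) * (x p * x p') := by
  have hx : x = ∑ p, x p • EuclideanSpace.single p (1 : ℝ) := by
    ext p
    simp [Pi.single_apply]
  rw [← real_inner_self_eq_norm_sq]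
  conv_lhs => rw [hx]
  simp only [map_sum, map_smul, sum_inner, inner_sum, real_inner_smul_left, real_inner_smul_right]
  exact Finset.sum_congr rfl fun p _ => Finset.sum_congr rfl fun p' _ => by
    rw [real_inner_comm]; ring

/-- `κ` is the law of the arrivals (first component) and of the schedule (second component) of a
slot that starts with queue lengths `q`: the arrivals are at most `amax`, are uncorrelated, and have
means `rate` and variances `var`; the mean weight of the schedule is within `W` of the largest one.
-/
structure IsSlotLaw {n : ℕ} (κ : Measure (PacketMatrix n × PacketMatrix n)) (q : PacketMatrix n)
    (amax : ℕ) (W : ℝ) (rate : RealMatrix n) (var : Fin n × Fin n → ℝ) : Prop where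
  isProb : IsProbabilityMeasure κ
  arrival_le : ∀ᵐ r ∂κ, ∀ i j, r.1 i j ≤ amax
  schedule_mem : ∀ᵐ r ∂κ, r.2 ∈ schedules n
  mean : ∀ p, ∫ r, toReal r.1 p ∂κ = rate p
  cov : ∀ p p', ∫ r, (toReal r.1 p - rate p) * (toReal r.1 p' - rate p') ∂κ
    = if p = p' then var p else 0
  maxWeight_le : (maxWeight q : ℝ) - W ≤ ∫ r, (weight q r.2 : ℝ) ∂κ

namespace IsSlotLaw

variable {n amax : ℕ} {κ : Measure (PacketMatrix n × PacketMatrix n)} {q : PacketMatrix n}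
  {W : ℝ} {rate : RealMatrix n} {var : Fin n × Fin n → ℝ}

theorem integrable (h : IsSlotLaw κ q amax W rate var) (F : PacketMatrix n × PacketMatrix n → ℝ) :
    Integrable F κ := by
  have := h.isProb
  have hfin : (Set.Iic (fun _ _ => amax : PacketMatrix n) ×ˢ schedules n).Finite :=
    (Set.finite_Iic _).prod (Set.finite_range _)
  obtain ⟨C, hC⟩ := (hfin.image fun r => ‖F r‖).bddAbove
  refine .of_bound Measurable.of_discrete.aestronglyMeasurable C ?_
  filter_upwards [h.arrival_le, h.schedule_mem] with r ha hs
  exact hC ⟨r, ⟨ha, hs⟩, rfl⟩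

theorem integral_inner_arrival (h : IsSlotLaw κ q amax W rate var) (x : RealMatrix n) :
    ∫ r, inner ℝ x (toReal r.1) ∂κ = inner ℝ x rate := by
  simp only [PiLp.inner_apply, RCLike.inner_apply, conj_trivial]
  rw [integral_finsetSum _ fun _ _ => h.integrable _]
  exact Finset.sum_congr rfl fun p _ => by rw [integral_mul_const, h.mean]

theorem integral_norm_sq_map_arrival_sub (h : IsSlotLaw κ q amax W rate var)
    (T : RealMatrix n →L[ℝ] RealMatrix n) (c : RealMatrix n) :
    ∫ r, ‖T (toReal r.1) - c‖ ^ 2 ∂κ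
      = ∑ p, ‖T (EuclideanSpace.single p 1)‖ ^ 2 * var p + ‖T rate - c‖ ^ 2 := by
  have := h.isProb
  have hcentered : ∫ r, ‖T (toReal r.1 - rate)‖ ^ 2 ∂κ
      = ∑ p, ‖T (EuclideanSpace.single p 1)‖ ^ 2 * var p := by
    simp only [norm_sq_map_eq_sum T (_ - _), PiLp.sub_apply]
    rw [integral_finsetSum _ fun _ _ => h.integrable _]
    refine Finset.sum_congr rfl fun p _ => ?_
    rw [integral_finsetSum _ fun _ _ => h.integrable _]
    simp only [integral_const_mul, h.cov]
    simp
  set x := ContinuousLinearMap.adjoint T (T rate - c) with hx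
  have hcross : ∫ r, 2 * (inner ℝ x (toReal r.1) - inner ℝ x rate) ∂κ = 0 := by
    rw [integral_const_mul, integral_sub (h.integrable _) (integrable_const _),
      h.integral_inner_arrival]
    simp
  have hexpand : ∀ r : PacketMatrix n × PacketMatrix n, ‖T (toReal r.1) - c‖ ^ 2
      = ‖T (toReal r.1 - rate)‖ ^ 2 + 2 * (inner ℝ x (toReal r.1) - inner ℝ x rate)
        + ‖T rate - c‖ ^ 2 := fun r => by
    rw [show T (toReal r.1) - c = T (toReal r.1 - rate) + (T rate - c) by rw [map_sub]; abel,
      norm_add_sq_real, ← inner_sub_right, hx, ContinuousLinearMap.adjoint_inner_left,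
      real_inner_comm (T rate - c)]
  simp only [hexpand]
  rw [integral_add (h.integrable _) (integrable_const _),
    integral_add (h.integrable _) (h.integrable _), hcentered, hcross]
  simp

theorem integral_add_two_mul_inner_sub_weight_le (h : IsSlotLaw κ q amax W rate var) (C : ℝ)
    (x : RealMatrix n) :
    ∫ r, (C + 2 * (inner ℝ x (toReal r.1) - weight q r.2)) ∂κ
      ≤ C + 2 * (inner ℝ x rate - maxWeight q + W) := by
  have := h.isProb
  rw [integral_const_add_const_mul (h.integrable _),
    integral_sub (h.integrable _) (h.integrable _), h.integral_inner_arrival]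
  linarith [h.maxWeight_le]

variable {ν : Matrix (Fin n) (Fin n) ℝ} {ε δ η : ℝ}

theorem integral_norm_sq_nextQueue_le (h : IsSlotLaw κ q amax W ((1 - ε) • ofMatrix ν) var)
    (hν : ν ∈ doublyStochastic ℝ (Fin n)) (hδ : 0 ≤ δ) (hδν : ∀ i j, δ ≤ ν i j) (hε : 0 ≤ ε) :
    ∫ r, ‖toReal (nextQueue q r.1 r.2)‖ ^ 2 ∂κ
      ≤ ‖toReal q‖ ^ 2 - 2 * ε * δ * ‖toReal q‖ + (2 * W + (n * (amax + 1 : ℝ)) ^ 2) := by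
  have hle : ∫ r, ‖toReal (nextQueue q r.1 r.2)‖ ^ 2 ∂κ
      ≤ ∫ r, (‖toReal q‖ ^ 2 + (n * (amax + 1 : ℝ)) ^ 2
        + 2 * (inner ℝ (toReal q) (toReal r.1) - weight q r.2)) ∂κ := by
    refine integral_mono_ae (h.integrable _) (h.integrable _) ?_
    filter_upwards [h.arrival_le, h.schedule_mem] with r ha hs using norm_sq_nextQueue_le q ha hs
  have hrate : δ * ‖toReal q‖ ≤ inner ℝ (toReal q) (ofMatrix ν) := by
    calc δ * ‖toReal q‖ ≤ δ * total q := by gcongr; exact norm_le_total q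
      _ = ∑ i, ∑ j, (q i j : ℝ) * δ := by simp only [total, Finset.mul_sum, mul_comm]
      _ ≤ inner ℝ (toReal q) (ofMatrix ν) := by
        rw [inner_eq_sum]
        simp only [toReal_apply, ofMatrix_apply]
        gcongr with i _ j _
        exact hδν i j
  have hmean := hle.trans (h.integral_add_two_mul_inner_sub_weight_le _ _)
  rw [real_inner_smul_right] at hmean
  linarith [inner_le_maxWeight q hν, mul_le_mul_of_nonneg_left hrate hε]

theorem integral_norm_sq_perpCone_nextQueue_le
    (h : IsSlotLaw κ q amax W ((1 - ε) • ofMatrix ν) var) (hν : ν ∈ doublyStochastic ℝ (Fin n))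
    (hδ : 0 ≤ δ) (hδν : ∀ i j, δ ≤ ν i j) (hε : 0 ≤ ε) (hεδ : ε * ‖ofMatrix ν‖ ≤ δ / 2) :
    ∫ r, ‖perpCone (toReal (nextQueue q r.1 r.2))‖ ^ 2 ∂κ
      ≤ ‖perpCone (toReal q)‖ ^ 2 - δ * ‖perpCone (toReal q)‖
        + (2 * W + (n * (amax + 1 : ℝ)) ^ 2) := by
  set z := perpCone (toReal q) with hz
  have hle : ∫ r, ‖perpCone (toReal (nextQueue q r.1 r.2))‖ ^ 2 ∂κ
      ≤ ∫ r, (‖z‖ ^ 2 + (n * (amax + 1 : ℝ)) ^ 2 + 2 * inner ℝ (projCone (toReal q)) (ofMatrix ν)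
        + 2 * (inner ℝ z (toReal r.1) - weight q r.2)) ∂κ := by
    refine integral_mono_ae (h.integrable _) (h.integrable _) ?_
    filter_upwards [h.arrival_le, h.schedule_mem] with r ha hs
      using norm_sq_perpCone_nextQueue_le q ha hs hν
  have hsplit : inner ℝ (toReal q) (ofMatrix ν)
      = inner ℝ (projCone (toReal q)) (ofMatrix ν) + inner ℝ z (ofMatrix ν) := by
    rw [← inner_add_left, hz, projCone_add_perpCone]
  have hslack : ε * (-inner ℝ z (ofMatrix ν)) ≤ δ / 2 * ‖z‖ := by
    calc ε * (-inner ℝ z (ofMatrix ν)) ≤ ε * (‖z‖ * ‖ofMatrix ν‖) := by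
          gcongr
          exact (neg_le_abs _).trans (abs_real_inner_le_norm _ _)
      _ = ε * ‖ofMatrix ν‖ * ‖z‖ := by ring
      _ ≤ δ / 2 * ‖z‖ := by gcongr
  have hmean := hle.trans (h.integral_add_two_mul_inner_sub_weight_le _ _)
  rw [real_inner_smul_right] at hmean
  linarith [inner_add_mul_norm_perpCone_le_maxWeight q hν hδ hδν]

theorem integral_total_nextQueue (h : IsSlotLaw κ q amax W ((1 - ε) • ofMatrix ν) var)
    (hν : ν ∈ doublyStochastic ℝ (Fin n)) :
    ∫ r, total (nextQueue q r.1 r.2) ∂κ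
      = total q - n * ε + ∫ r, total (unused q r.1 r.2) ∂κ := by
  have := h.isProb
  set e : RealMatrix n := WithLp.toLp 2 fun _ => 1 with he
  have htotal : ∀ a : PacketMatrix n, total a = inner ℝ e (toReal a) := fun a => by
    simp [inner_eq_sum, he, total]
  have harrival : ∫ r, total r.1 ∂κ = (1 - ε) * n := by
    simp only [htotal]
    rw [h.integral_inner_arrival, real_inner_smul_right, inner_eq_sum]
    simp [he, sum_row_of_mem_doublyStochastic hν]
  calc ∫ r, total (nextQueue q r.1 r.2) ∂κ
      = ∫ r, (total q + total r.1 - n + total (unused q r.1 r.2)) ∂κ :=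
        integral_congr_ae (h.schedule_mem.mono fun r => total_nextQueue q r.1)
    _ = total q + (1 - ε) * n - n + ∫ r, total (unused q r.1 r.2) ∂κ := by
        rw [integral_add (h.integrable _) (h.integrable _),
          integral_sub (h.integrable _) (integrable_const _),
          integral_add (integrable_const _) (h.integrable _), harrival]
        simp
    _ = total q - n * ε + ∫ r, total (unused q r.1 r.2) ∂κ := by ring

theorem integral_norm_sq_projSpace_arrival (hn : 0 < n)
    (h : IsSlotLaw κ q amax W ((1 - ε) • ofMatrix ν) var) (hν : ν ∈ doublyStochastic ℝ (Fin n)) :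
    ∫ r, ‖projSpace n (toReal r.1) - uniformMatrix n‖ ^ 2 ∂κ
      = (2 * n - 1) / (n : ℝ) ^ 2 * ∑ p, var p + ε ^ 2 := by
  have hbias : projSpace n ((1 - ε) • ofMatrix ν) - uniformMatrix n = (-ε) • uniformMatrix n := by
    rw [map_smul, projSpace_eq_uniformMatrix hn (sum_row_of_mem_doublyStochastic hν)
      (sum_col_of_mem_doublyStochastic hν)]
    module
  rw [h.integral_norm_sq_map_arrival_sub, hbias, norm_smul, mul_pow, norm_sq_uniformMatrix hn]
  simp [norm_sq_projSpace_single hn, Finset.mul_sum]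

theorem integral_norm_sq_projSpace_nextQueue (hn : 0 < n)
    (h : IsSlotLaw κ q amax W ((1 - ε) • ofMatrix ν) var) (hν : ν ∈ doublyStochastic ℝ (Fin n)) :
    ∫ r, ‖projSpace n (toReal (nextQueue q r.1 r.2))‖ ^ 2 ∂κ
      = ‖projSpace n (toReal q)‖ ^ 2 - 2 * ε * total q / n
        + ((2 * n - 1) / (n : ℝ) ^ 2 * ∑ p, var p + ε ^ 2)
        - ∫ r, unusedError q r.1 r.2 ∂κ := by
  have := h.isProb
  have hproj : inner ℝ (projSpace n (toReal q)) (ofMatrix ν) = total q / n := by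
    rw [inner_projSpace_left, projSpace_eq_uniformMatrix hn (sum_row_of_mem_doublyStochastic hν)
      (sum_col_of_mem_doublyStochastic hν), inner_uniformMatrix]
    rfl
  rw [integral_congr_ae (h.schedule_mem.mono fun r => norm_sq_projSpace_nextQueue hn q r.1),
    integral_sub (h.integrable _) (h.integrable _), integral_add (h.integrable _) (h.integrable _),
    integral_const_add_const_mul (h.integrable _), h.integral_inner_arrival,
    h.integral_norm_sq_projSpace_arrival hn hν, real_inner_smul_right, hproj]
  ring

theorem abs_integral_unusedError_le (h : IsSlotLaw κ q amax W ((1 - ε) • ofMatrix ν) var)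
    (hν : ν ∈ doublyStochastic ℝ (Fin n)) (hη : 0 < η) :
    |∫ r, unusedError q r.1 r.2 ∂κ|
      ≤ η * ∫ r, ‖perpCone (toReal (nextQueue q r.1 r.2))‖ ^ 2 ∂κ
        + (1 / η + 1) * (∫ r, total (nextQueue q r.1 r.2) ∂κ - total q + n * ε) := by
  calc |∫ r, unusedError q r.1 r.2 ∂κ|
      ≤ ∫ r, |unusedError q r.1 r.2| ∂κ := abs_integral_le_integral_abs
    _ ≤ ∫ r, (η * ‖perpCone (toReal (nextQueue q r.1 r.2))‖ ^ 2
          + (1 / η + 1) * total (unused q r.1 r.2)) ∂κ :=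
        integral_mono_ae (h.integrable _) (h.integrable _)
          (h.schedule_mem.mono fun r hs => abs_unusedError_le q r.1 hs hη)
    _ = η * ∫ r, ‖perpCone (toReal (nextQueue q r.1 r.2))‖ ^ 2 ∂κ
          + (1 / η + 1) * ∫ r, total (unused q r.1 r.2) ∂κ := by
        rw [integral_add (h.integrable _) (h.integrable _), integral_const_mul, integral_const_mul]
    _ = _ := by rw [h.integral_total_nextQueue hν]; ring

end IsSlotLaw

theorem measure_eq_tsum_inter_preimage {Ω S : Type*} [MeasurableSpace Ω] [Countable S]
    [MeasurableSpace S] [MeasurableSingletonClass S] (μ : Measure Ω) {Z : Ω → S} (hZ : Measurable Z)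
    (A : Set Ω) : μ A = ∑' z, μ (A ∩ Z ⁻¹' {z}) := by
  have h := tsum_measure_preimage_singleton (μ := μ.restrict A) Set.countable_univ
    fun z _ => hZ (measurableSet_singleton z)
  rw [tsum_univ fun z => μ.restrict A (Z ⁻¹' {z})] at h
  simpa [Measure.restrict_apply (hZ (measurableSet_singleton _)), Set.inter_comm] using h.symm

theorem toMeasure_le_liminf {S : Type*} [MeasurableSpace S] [DiscreteMeasurableSpace S]
    {p : ℕ → PMF S} {π : PMF S} (h : ∀ x, Tendsto (fun t => p t x) atTop (𝓝 (π x))) (A : Set S) :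
    π.toMeasure A ≤ liminf (fun t => (p t).toMeasure A) atTop := by
  classical
  simp only [PMF.toMeasure_apply _ (MeasurableSet.of_discrete (s := A)), ← lintegral_count]
  calc ∫⁻ x, A.indicator π x ∂Measure.count
      = ∫⁻ x, liminf (fun t => A.indicator (p t) x) atTop ∂Measure.count := by
        refine lintegral_congr fun x => (Tendsto.liminf_eq ?_).symm
        by_cases hx : x ∈ A <;> simp [hx, h]
    _ ≤ _ := lintegral_liminf_le fun t => Measurable.of_discrete

namespace SwitchSystem

variable {n : ℕ} {M : SwitchSystem.{u} n}

theorem q_succ_eq (t : ℕ) (ω : M.Ω) :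
    M.q (t + 1) ω = nextQueue (M.q t ω) (M.a t ω) (M.s t ω) := by
  funext i j
  have := M.q_succ t ω i j
  simp only [nextQueue]
  omega

namespace StateChain

variable (Y : StateChain.{u, v} M)

instance : Countable Y.S := Y.countable

instance : Nonempty Y.S := (nonempty_of_isProbabilityMeasure M.μ).map (Y.X 0)

instance : MeasurableSpace Y.S := ⊤

instance : DiscreteMeasurableSpace Y.S := ⟨fun _ => trivial⟩

theorem measurable_X (t : ℕ) : Measurable (Y.X t) :=
  measurable_to_countable' (Y.measurableSet_eq t)

theorem measure_state_and_next (t : ℕ) (x y : Y.S) :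
    M.μ ({ω | Y.X t ω = x} ∩ {ω | Y.X (t + 1) ω = y}) = M.μ {ω | Y.X t ω = x} * Y.P x y := by
  let past : M.Ω → Fin t → Y.S := fun ω k => Y.X k ω
  have hpast : Measurable past := measurable_pi_lambda _ fun k => Y.measurable_X k
  let path : (Fin t → Y.S) → ℕ → Y.S := fun h k => if hk : k < t then h ⟨k, hk⟩ else x
  have hpath : ∀ h, {ω | Y.X t ω = x} ∩ past ⁻¹' {h} = {ω | ∀ k ≤ t, Y.X k ω = path h k} := by
    intro h
    ext ω
    simp only [Set.mem_inter_iff, Set.mem_ofPred_eq, Set.mem_preimage, Set.mem_singleton_iff,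
      funext_iff, Fin.forall_iff, le_iff_lt_or_eq, or_imp, forall_and, forall_eq, path, past,
      lt_irrefl, dite_false, and_comm (a := Y.X t ω = x)]
    exact and_congr_left fun _ => forall₂_congr fun k hk => by rw [dif_pos hk]
  have hmarkov : ∀ h, M.μ ({ω | Y.X t ω = x} ∩ {ω | Y.X (t + 1) ω = y} ∩ past ⁻¹' {h})
      = M.μ ({ω | Y.X t ω = x} ∩ past ⁻¹' {h}) * Y.P x y := by
    intro h
    rw [Set.inter_right_comm, hpath, ← Set.ofPred_and, Y.markov t (path h) y]
    simp [path]
  rw [measure_eq_tsum_inter_preimage M.μ hpast {ω | Y.X t ω = x},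
    measure_eq_tsum_inter_preimage M.μ hpast, ← ENNReal.tsum_mul_right]
  exact tsum_congr hmarkov

instance (t : ℕ) : IsProbabilityMeasure (M.μ.map (Y.X t)) :=
  Measure.isProbabilityMeasure_map (Y.measurable_X t).aemeasurable

/-- The law of the state in slot `t`. -/
noncomputable def law (t : ℕ) : PMF Y.S := (M.μ.map (Y.X t)).toPMF

theorem law_apply (t : ℕ) (x : Y.S) : Y.law t x = M.μ {ω | Y.X t ω = x} := by
  rw [law, Measure.toPMF_apply, Measure.map_apply (Y.measurable_X t) (measurableSet_singleton x)]
  rfl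

theorem law_succ (t : ℕ) : Y.law (t + 1) = (Y.law t).bind Y.P := by
  ext y
  rw [PMF.bind_apply, law_apply, measure_eq_tsum_inter_preimage M.μ (Y.measurable_X t)]
  refine tsum_congr fun x => ?_
  rw [law_apply, ← measure_state_and_next, Set.inter_comm]
  rfl

theorem law_eq (t : ℕ) : Y.law t = (Y.law 0).bind (step Y.P t) := by
  induction t with
  | zero => exact (PMF.bind_pure _).symm
  | succ t ih =>
    rw [law_succ, ih, PMF.bind_bind]
    congr 1
    funext x
    rw [step_add, funext (step_one Y.P)]

theorem exists_measure_state_ne_zero (hI : Irreducible Y.P) (x : Y.S) :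
    ∃ t, M.μ {ω | Y.X t ω = x} ≠ 0 := by
  obtain ⟨z, hz⟩ := (Y.law 0).support_nonempty
  obtain ⟨t, ht⟩ := hI z x
  refine ⟨t, ?_⟩
  rw [← law_apply, law_eq, ← PMF.mem_support_iff, PMF.mem_support_bind_iff]
  exact ⟨z, hz, by rw [PMF.mem_support_iff, step_apply]; exact ht.ne'⟩

theorem tendsto_law {π : PMF Y.S} (hπ : IsLimitLaw Y.P π) (y : Y.S) :
    Tendsto (fun t => Y.law t y) atTop (𝓝 (π y)) := by
  have hlaw : ∀ t, Y.law t y = ∫⁻ x, step Y.P t x y ∂(Y.law 0).toMeasure := fun t => by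
    rw [law_eq, PMF.bind_apply, ← mean_eq_lintegral, mean]
  have hconst : π y = ∫⁻ _, π y ∂(Y.law 0).toMeasure := by simp
  simp only [hlaw]
  rw [hconst]
  exact tendsto_lintegral_of_dominated_convergence 1 (fun t => .of_discrete)
    (fun t => ae_of_all _ fun x => PMF.coe_le_one _ _) (by simp) (ae_of_all _ fun x => hπ x y)

theorem isSteadyState {π : PMF Y.S} (hπ : IsLimitLaw Y.P π) {g : Y.S → PacketMatrix n}
    (hg : Y.CondA2 g) {Q : ProbabilityMeasure (PacketMatrix n)}
    (hQ : (Q : Measure (PacketMatrix n)) = π.toMeasure.map g) : M.IsSteadyState Q := by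
  refine ⟨fun t => (M.measurable_q t).aemeasurable, aemeasurable_id,
    tendsto_of_forall_isOpen_le_liminf' fun G hG => ?_⟩
  have hq : ∀ t, (M.μ.map (M.q t)) G = (Y.law t).toMeasure (g ⁻¹' G) := fun t => by
    rw [law, Measure.toPMF_toMeasure, Measure.map_apply (Y.measurable_X t) .of_discrete,
      Measure.map_apply (M.measurable_q t) hG.measurableSet, ← Set.preimage_comp]
    exact congrArg (fun f => M.μ (f ⁻¹' G)) (funext (hg.1 t))
  change Measure.map id (Q : Measure (PacketMatrix n)) G
    ≤ liminf (fun t => (M.μ.map (M.q t)) G) atTop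
  simp only [Measure.map_id, hQ, hq, Measure.map_apply Measurable.of_discrete hG.measurableSet]
  exact toMeasure_le_liminf (Y.tendsto_law hπ) _

variable {Y} in
theorem map_next_cond {t : ℕ} {x : Y.S} (hx : M.μ {ω | Y.X t ω = x} ≠ 0) :
    (cond M.μ {ω | Y.X t ω = x}).map (Y.X (t + 1)) = (Y.P x).toMeasure := by
  refine Measure.ext_of_singleton fun y => ?_
  rw [Measure.map_apply (Y.measurable_X _) (measurableSet_singleton y),
    cond_apply (Y.measurableSet_eq t x), PMF.toMeasure_apply_singleton _ _ .of_discrete]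
  change _ * M.μ ({ω | Y.X t ω = x} ∩ {ω | Y.X (t + 1) ω = y}) = _
  rw [measure_state_and_next, ← mul_assoc, ENNReal.inv_mul_cancel hx (measure_ne_top _ _), one_mul]

variable {Y} in
theorem map_arrival_cond (hA1 : Y.CondA1) {t : ℕ} {x : Y.S} (hx : M.μ {ω | Y.X t ω = x} ≠ 0) :
    (cond M.μ {ω | Y.X t ω = x}).map (M.a t) = M.μ.map (M.a t) := by
  ext B hB
  rw [Measure.map_apply (M.measurable_a t) hB, Measure.map_apply (M.measurable_a t) hB,
    cond_apply (Y.measurableSet_eq t x),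
    (Indep_iff _ _ _).1 (M.indep_history t) {ω | Y.X t ω = x} _
      (hA1.1 t (MeasurableSpace.measurableSet_top (s := {x}))) ⟨B, hB, rfl⟩,
    ← mul_assoc, ENNReal.inv_mul_cancel hx (measure_ne_top _ _), one_mul]

end StateChain

/-- The properties of the arrivals that determine the first two moments of the queue lengths: in
every slot the arrivals are at most `amax`, are uncorrelated, and have means `rate` and variances
`var`. -/
structure SecondOrderArrivals {n : ℕ} (M : SwitchSystem.{u} n) (amax : ℕ) (rate : RealMatrix n)
    (var : Fin n × Fin n → ℝ) : Prop where
  bounded : ∀ t, ∀ᵐ ω ∂M.μ, ∀ i j, M.a t ω i j ≤ amax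
  mean : ∀ t p, ∫ ω, toReal (M.a t ω) p ∂M.μ = rate p
  cov : ∀ t p p', ∫ ω, (toReal (M.a t ω) p - rate p) * (toReal (M.a t ω) p' - rate p') ∂M.μ
    = if p = p' then var p else 0

theorem ArrivalAssumption.secondOrderArrivals {amax : ℕ} (h : M.ArrivalAssumption amax)
    {rate : RealMatrix n} (hrate : ∀ i j, M.arrivalRate i j = rate (i, j)) :
    M.SecondOrderArrivals amax rate fun p => M.arrivalVariance p.1 p.2 := by
  have hslot : ∀ t i j (f : ℕ → ℝ), ∫ ω, f (M.a t ω i j) ∂M.μ = ∫ ω, f (M.a 0 ω i j) ∂M.μ :=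
    fun t i j f => ((h.identDistrib i j t).comp (u := f) .of_discrete).integral_eq
  have hmeas : ∀ t i j, Measurable fun ω => M.a t ω i j := fun t i j =>
    (Measurable.of_discrete (f := fun a : PacketMatrix n => a i j)).comp (M.measurable_a t)
  have hmean : ∀ t p, ∫ ω, toReal (M.a t ω) p ∂M.μ = rate p :=
    fun t p => (hslot t p.1 p.2 fun k => (k : ℝ)).trans (hrate p.1 p.2)
  refine ⟨fun t => ae_of_all _ (h.bounded t), hmean, fun t p p' => ?_⟩
  split_ifs with hp
  · subst hp
    have hX : AEMeasurable (fun ω => (M.a 0 ω p.1 p.2 : ℝ)) M.μ :=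
      (Measurable.of_discrete.comp (hmeas 0 p.1 p.2)).aemeasurable
    rw [arrivalVariance, variance_eq_integral hX]
    simp only [← sq]
    refine (hslot t p.1 p.2 fun k => ((k : ℝ) - rate p) ^ 2).trans ?_
    rw [← hrate p.1 p.2, arrivalRate]
  · have hindep := (h.indep_pair t p.1 p.2 p'.1 p'.2 hp).comp
      (φ := fun k : ℕ => (k : ℝ)) (ψ := fun k : ℕ => (k : ℝ)) .of_discrete .of_discrete
    have hLp : ∀ p : Fin n × Fin n, MemLp (fun ω => (M.a t ω p.1 p.2 : ℝ)) 2 M.μ := fun p =>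
      .of_bound (Measurable.of_discrete.comp (hmeas t p.1 p.2)).aestronglyMeasurable amax <|
        ae_of_all _ fun ω => by simpa using h.bounded t ω p.1 p.2
    rw [← hindep.covariance_eq_zero (hLp p) (hLp p'), covariance]
    simp only [← hmean t]
    rfl

end SwitchSystem

/-- One step of the chain with transition matrix `P`, whose state `x` has queue lengths `g x`, is
one slot of a switch in the sense of `IsSlotLaw`. -/
def IsSwitchKernel {S : Type v} [MeasurableSpace S] {n : ℕ} (P : S → PMF S)
    (g : S → PacketMatrix n) (amax : ℕ) (W : ℝ) (rate : RealMatrix n)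
    (var : Fin n × Fin n → ℝ) : Prop :=
  ∀ x, ∃ κ, IsSlotLaw κ (g x) amax W rate var ∧
    (P x).toMeasure.map g = κ.map fun r => nextQueue (g x) r.1 r.2

namespace SwitchSystem.StateChain

variable {n amax : ℕ} {M : SwitchSystem.{u} n} {Y : StateChain.{u, v} M} {W : ℝ}
  {rate : RealMatrix n} {var : Fin n × Fin n → ℝ} {g : Y.S → PacketMatrix n}

theorem isSlotLaw_cond (hA : M.SecondOrderArrivals amax rate var) (hA1 : Y.CondA1)
    (hA2 : Y.CondA2 g) (hW : Y.NearMaxWeight g W) {t : ℕ} {x : Y.S}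
    (hx : M.μ {ω | Y.X t ω = x} ≠ 0) :
    IsSlotLaw ((cond M.μ {ω | Y.X t ω = x}).map fun ω => (M.a t ω, M.s t ω)) (g x) amax W rate
      var := by
  have hprob := cond_isProbabilityMeasure hx
  have hr : Measurable fun ω => (M.a t ω, M.s t ω) := (M.measurable_a t).prodMk (M.measurable_s t)
  have hint : ∀ F : PacketMatrix n × PacketMatrix n → ℝ,
      ∫ r, F r ∂(cond M.μ {ω | Y.X t ω = x}).map (fun ω => (M.a t ω, M.s t ω))
        = ∫ ω, F (M.a t ω, M.s t ω) ∂cond M.μ {ω | Y.X t ω = x} := fun F =>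
    integral_map hr.aemeasurable Measurable.of_discrete.aestronglyMeasurable
  have harr : ∀ F : PacketMatrix n → ℝ,
      ∫ ω, F (M.a t ω) ∂cond M.μ {ω | Y.X t ω = x} = ∫ ω, F (M.a t ω) ∂M.μ := fun F => by
    have hF : ∀ m : Measure (PacketMatrix n), AEStronglyMeasurable F m := fun m =>
      Measurable.of_discrete.aestronglyMeasurable
    rw [← integral_map (M.measurable_a t).aemeasurable (hF _), map_arrival_cond hA1 hx,
      integral_map (M.measurable_a t).aemeasurable (hF _)]
  refine ⟨Measure.isProbabilityMeasure_map hr.aemeasurable, ?_, ?_, fun p => ?_, fun p p' => ?_, ?_⟩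
  · refine (ae_map_iff hr.aemeasurable .of_discrete).2 ?_
    exact cond_absolutelyContinuous.ae_le (hA.bounded t)
  · exact (ae_map_iff hr.aemeasurable .of_discrete).2 (ae_of_all _ (M.s_mem t))
  · rw [hint, harr fun a => toReal a p, hA.mean]
  · rw [hint, harr fun a => (toReal a p - rate p) * (toReal a p' - rate p'), hA.cov]
  · rw [hint]
    refine (hW t x hx).trans_eq (integral_congr_ae ?_)
    filter_upwards [ae_cond_mem (Y.measurableSet_eq t x)] with ω hω
    rw [hA2.1, show Y.X t ω = x from hω]

theorem isSwitchKernel (hA : M.SecondOrderArrivals amax rate var) (hA1 : Y.CondA1)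
    (hA2 : Y.CondA2 g) (hW : Y.NearMaxWeight g W) : IsSwitchKernel Y.P g amax W rate var := by
  intro x
  obtain ⟨t, ht⟩ := Y.exists_measure_state_ne_zero hA1.2.1 x
  refine ⟨_, isSlotLaw_cond hA hA1 hA2 hW ht, ?_⟩
  rw [← map_next_cond ht, Measure.map_map .of_discrete (Y.measurable_X _),
    Measure.map_map .of_discrete ((M.measurable_a t).prodMk (M.measurable_s t))]
  refine Measure.map_congr ?_
  filter_upwards [ae_cond_mem (Y.measurableSet_eq t x)] with ω hω
  simp only [Function.comp_apply, ← hA2.1, q_succ_eq, ← show Y.X t ω = x from hω]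

end SwitchSystem.StateChain

open scoped Nat

/-! ### Steady state -/

section Stationary

variable {S : Type*} [MeasurableSpace S] [DiscreteMeasurableSpace S] [Countable S]
  {P : S → PMF S} {π : PMF S} {f : S → ℝ}

/-- A transition matrix as a Markov kernel, which gives access to the integrals of kernels. -/
noncomputable def transitionKernel (P : S → PMF S) : Kernel S S :=
  Kernel.ofFunOfCountable fun x => (P x).toMeasure

theorem transitionKernel_comp_const (hπ : π.bind P = π) :
    (transitionKernel P ∘ₖ Kernel.const Unit π.toMeasure) () = π.toMeasure := by
  ext A hA
  conv_rhs => rw [← hπ, PMF.toMeasure_bind_apply _ _ _ hA]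
  rw [Kernel.comp_apply' _ _ _ hA, Kernel.const_apply, lintegral_countable']
  refine tsum_congr fun x => ?_
  rw [PMF.toMeasure_apply_singleton _ _ (measurableSet_singleton x), mul_comm]
  rfl

theorem integrable_integral_of_stationary (hπ : π.bind P = π) (hf : Integrable f π.toMeasure) :
    Integrable (fun x => ∫ y, f y ∂(P x).toMeasure) π.toMeasure := by
  rw [← transitionKernel_comp_const hπ] at hf
  exact hf.integral_comp

theorem integral_integral_of_stationary (hπ : π.bind P = π) (hf : Integrable f π.toMeasure) :
    ∫ x, ∫ y, f y ∂(P x).toMeasure ∂π.toMeasure = ∫ x, f x ∂π.toMeasure := by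
  have h := transitionKernel_comp_const hπ
  conv_rhs => rw [← h]
  rw [Kernel.integral_comp (h.symm ▸ hf)]
  rfl

theorem integrable_drift_of_stationary (hπ : π.bind P = π) (hf : Integrable f π.toMeasure) :
    Integrable (fun x => ∫ y, f y ∂(P x).toMeasure - f x) π.toMeasure :=
  (integrable_integral_of_stationary hπ hf).sub hf

theorem integral_drift_of_stationary (hπ : π.bind P = π) (hf : Integrable f π.toMeasure) :
    ∫ x, (∫ y, f y ∂(P x).toMeasure - f x) ∂π.toMeasure = 0 := by
  rw [integral_sub (integrable_integral_of_stationary hπ hf) hf,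
    integral_integral_of_stationary hπ hf, sub_self]

theorem abs_integral_le_of_abs_drift_add_le (hπ : π.bind P = π) {f' c c' : S → ℝ}
    (hf : Integrable f π.toMeasure) (hf' : Integrable f' π.toMeasure)
    (hc : Integrable c π.toMeasure) (hc' : Integrable c' π.toMeasure)
    (h : ∀ x, |∫ y, f y ∂(P x).toMeasure - f x + c x|
      ≤ ∫ y, f' y ∂(P x).toMeasure - f' x + c' x) :
    |∫ x, c x ∂π.toMeasure| ≤ ∫ x, c' x ∂π.toMeasure := by
  have hint : ∀ {f c : S → ℝ}, Integrable f π.toMeasure → Integrable c π.toMeasure →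
      ∫ x, (∫ y, f y ∂(P x).toMeasure - f x + c x) ∂π.toMeasure = ∫ x, c x ∂π.toMeasure :=
    fun hf hc => by
      rw [integral_add (integrable_drift_of_stationary hπ hf) hc,
        integral_drift_of_stationary hπ hf, zero_add]
  rw [← hint hf hc, ← hint hf' hc']
  exact abs_integral_le_integral_abs.trans <| integral_mono
    ((integrable_drift_of_stationary hπ hf).add hc).abs
    ((integrable_drift_of_stationary hπ hf').add hc') h

end Stationary

section Moments

variable {S : Type*} [MeasurableSpace S] [DiscreteMeasurableSpace S] {π : PMF S} {N : S → ℝ}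
  {θ : ℝ} {c : ℝ≥0}

theorem pow_le_factorial_div_mul_exp (hθ : 0 < θ) {x : ℝ} (hx : 0 ≤ x) (r : ℕ) :
    x ^ r ≤ r ! / θ ^ r * Real.exp (θ * x) := by
  have h := Real.pow_div_factorial_le_exp (θ * x) (by positivity) r
  rw [div_le_iff₀ (by positivity), mul_pow] at h
  rw [div_mul_eq_mul_div, le_div_iff₀ (by positivity)]
  linarith

theorem integrable_exp_of_mean_le [Countable S]
    (h : mean π (fun x => ((Real.exp (θ * N x)).toNNReal : ℝ≥0∞)) ≤ c) :
    Integrable (fun x => Real.exp (θ * N x)) π.toMeasure := by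
  rw [mean_eq_lintegral] at h
  refine ⟨Measurable.of_discrete.aestronglyMeasurable, ?_⟩
  rw [hasFiniteIntegral_iff_ofReal (ae_of_all _ fun x => (Real.exp_pos _).le)]
  exact h.trans_lt ENNReal.coe_lt_top

theorem integral_exp_le_of_mean_le [Countable S]
    (h : mean π (fun x => ((Real.exp (θ * N x)).toNNReal : ℝ≥0∞)) ≤ c) :
    ∫ x, Real.exp (θ * N x) ∂π.toMeasure ≤ c := by
  rw [mean_eq_lintegral] at h
  rw [integral_eq_lintegral_of_nonneg_ae (ae_of_all _ fun x => (Real.exp_pos _).le)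
    Measurable.of_discrete.aestronglyMeasurable]
  exact ENNReal.toReal_le_coe_of_le_coe h

theorem integrable_pow_of_integrable_exp (hθ : 0 < θ) (hN : ∀ x, 0 ≤ N x)
    (h : Integrable (fun x => Real.exp (θ * N x)) π.toMeasure) (r : ℕ) :
    Integrable (fun x => N x ^ r) π.toMeasure :=
  (h.const_mul (r ! / θ ^ r)).mono' Measurable.of_discrete.aestronglyMeasurable <|
    ae_of_all _ fun x => by
      rw [Real.norm_of_nonneg (pow_nonneg (hN x) r)]
      exact pow_le_factorial_div_mul_exp hθ (hN x) r

theorem integral_pow_le_of_integrable_exp (hθ : 0 < θ) (hN : ∀ x, 0 ≤ N x)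
    (h : Integrable (fun x => Real.exp (θ * N x)) π.toMeasure) (r : ℕ) :
    ∫ x, N x ^ r ∂π.toMeasure ≤ r ! / θ ^ r * ∫ x, Real.exp (θ * N x) ∂π.toMeasure := by
  rw [← integral_const_mul]
  exact integral_mono (integrable_pow_of_integrable_exp hθ hN h r) (h.const_mul _) fun x =>
    pow_le_factorial_div_mul_exp hθ (hN x) r

end Moments

theorem finite_sublevel_exp_norm {S : Type*} {n : ℕ} {g : S → PacketMatrix n}
    (hg : ∀ A : Set (PacketMatrix n), A.Finite → (g ⁻¹' A).Finite) {θ : ℝ} (hθ : 0 < θ)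
    (R : ℝ≥0) : {x | (Real.exp (θ * ‖toReal (g x)‖)).toNNReal ≤ R}.Finite := by
  refine (hg _ (Set.finite_Iic fun _ _ => ⌈(R : ℝ) / θ⌉₊)).subset fun x hx i j => ?_
  have hexp : Real.exp (θ * ‖toReal (g x)‖) ≤ R := Real.toNNReal_le_iff_le_coe.1 hx
  have hentry : (g x i j : ℝ) ≤ ‖toReal (g x)‖ := by
    simpa using PiLp.norm_apply_le (toReal (g x)) (i, j)
  have hle : (g x i j : ℝ) ≤ R / θ := by
    rw [le_div_iff₀ hθ]
    linarith [Real.add_one_le_exp (θ * ‖toReal (g x)‖), mul_le_mul_of_nonneg_left hentry hθ.le]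
  exact_mod_cast hle.trans (Nat.le_ceil _)

namespace IsSwitchKernel

variable {S : Type v} [MeasurableSpace S] [DiscreteMeasurableSpace S] {P : S → PMF S} {π : PMF S}
  {n amax : ℕ} {g : S → PacketMatrix n} {W ε δ η : ℝ} {ν : Matrix (Fin n) (Fin n) ℝ}
  {rate : RealMatrix n} {var : Fin n × Fin n → ℝ}

theorem exists_isSlotLaw (h : IsSwitchKernel P g amax W rate var) (x : S) :
    ∃ κ, IsSlotLaw κ (g x) amax W rate var ∧ ∀ f : PacketMatrix n → ℝ,
      ∫ y, f (g y) ∂(P x).toMeasure = ∫ r, f (nextQueue (g x) r.1 r.2) ∂κ := by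
  obtain ⟨κ, hκ, hmap⟩ := h x
  refine ⟨κ, hκ, fun f => ?_⟩
  rw [← integral_map Measurable.of_discrete.aemeasurable
      Measurable.of_discrete.aestronglyMeasurable, hmap,
    integral_map Measurable.of_discrete.aemeasurable Measurable.of_discrete.aestronglyMeasurable]

theorem ae_norm_sub_le (h : IsSwitchKernel P g amax W rate var) (x : S) :
    ∀ᵐ y ∂(P x).toMeasure, ‖toReal (g y) - toReal (g x)‖ ≤ n * (amax + 1 : ℝ) := by
  obtain ⟨κ, hκ, hmap⟩ := h x
  refine ae_of_ae_map (p := fun q => ‖toReal q - toReal (g x)‖ ≤ n * (amax + 1 : ℝ))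
    Measurable.of_discrete.aemeasurable ?_
  rw [hmap, ae_map_iff Measurable.of_discrete.aemeasurable .of_discrete]
  filter_upwards [hκ.arrival_le, hκ.schedule_mem] with r ha hs using norm_nextQueue_sub_le _ ha hs

theorem abs_drift_norm_sq_projSpace_le (hn : 0 < n)
    (h : IsSwitchKernel P g amax W ((1 - ε) • ofMatrix ν) var)
    (hν : ν ∈ doublyStochastic ℝ (Fin n)) (hη : 0 < η) (x : S) :
    |∫ y, ‖projSpace n (toReal (g y))‖ ^ 2 ∂(P x).toMeasure - ‖projSpace n (toReal (g x))‖ ^ 2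
        + (2 * ε / n * total (g x) - ((2 * n - 1) / (n : ℝ) ^ 2 * ∑ p, var p + ε ^ 2))|
      ≤ ∫ y, (η * ‖perpCone (toReal (g y))‖ ^ 2 + (1 / η + 1) * total (g y)) ∂(P x).toMeasure
        - (η * ‖perpCone (toReal (g x))‖ ^ 2 + (1 / η + 1) * total (g x))
        + (η * ‖perpCone (toReal (g x))‖ ^ 2 + (1 / η + 1) * (n * ε)) := by
  obtain ⟨κ, hκ, hint⟩ := h.exists_isSlotLaw x
  rw [hint fun q => ‖projSpace n (toReal q)‖ ^ 2,
    hint fun q => η * ‖perpCone (toReal q)‖ ^ 2 + (1 / η + 1) * total q,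
    hκ.integral_norm_sq_projSpace_nextQueue hn hν,
    integral_add (hκ.integrable _) (hκ.integrable _), integral_const_mul, integral_const_mul]
  refine (le_of_eq ?_).trans ((hκ.abs_integral_unusedError_le hν hη).trans_eq (by ring))
  rw [← abs_neg]
  congr 1
  ring

variable [Countable S]

theorem exists_isLimitLaw_integrable (hn : 0 < n)
    (h : IsSwitchKernel P g amax W ((1 - ε) • ofMatrix ν) var)
    (hI : Irreducible P) (hA : Aperiodic P) [Nonempty S]
    (hg : ∀ A : Set (PacketMatrix n), A.Finite → (g ⁻¹' A).Finite)
    (hν : ν ∈ doublyStochastic ℝ (Fin n)) (hδ : 0 < δ) (hδν : ∀ i j, δ ≤ ν i j) (hε : 0 < ε) :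
    ∃ π, IsLimitLaw P π ∧ ∀ r, Integrable (fun x => ‖toReal (g x)‖ ^ r) π.toMeasure := by
  have hD : (0 : ℝ) < n * (amax + 1 : ℝ) := by positivity
  obtain ⟨θ, hθ, γ, b, hγ, hexp⟩ := exists_geometricDrift_exp hD (show 0 < 2 * ε * δ by positivity)
    (2 * W + (n * (amax + 1 : ℝ)) ^ 2)
  have hdrift : GeometricDrift P (fun x => (Real.exp (θ * ‖toReal (g x)‖)).toNNReal) γ b := by
    refine hexp P _ (fun x => ?_) fun x => ?_
    · exact (h.ae_norm_sub_le x).mono fun y hy => (abs_norm_sub_norm_le _ _).trans hy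
    · obtain ⟨κ, hκ, hint⟩ := h.exists_isSlotLaw x
      rw [hint fun q => ‖toReal q‖ ^ 2]
      exact hκ.integral_norm_sq_nextQueue_le hν hδ.le hδν hε.le
  obtain ⟨e, he⟩ := exists_forgetsStart hI hA hγ hdrift (finite_sublevel_exp_norm hg hθ)
  obtain ⟨π, hπ⟩ := he.exists_isLimitLaw
  obtain ⟨c, hc⟩ := exists_drift_fixed_point hγ b
  exact ⟨π, hπ, integrable_pow_of_integrable_exp hθ (fun x => norm_nonneg _)
    (integrable_exp_of_mean_le (hπ.mean_le_of_drift hγ hdrift hc))⟩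

theorem exists_moment_norm_perpCone_le (hn : 0 < n) (hν : ν ∈ doublyStochastic ℝ (Fin n))
    (hδ : 0 < δ) (hδν : ∀ i j, δ ≤ ν i j) (amax : ℕ) (W : ℝ) :
    ∃ ε₀ : ℝ, 0 < ε₀ ∧ ∃ C : ℕ → ℝ, ∀ {S : Type v} [MeasurableSpace S] [DiscreteMeasurableSpace S]
      [Countable S] {P : S → PMF S} {π : PMF S} {g : S → PacketMatrix n} {ε : ℝ}
      {var : Fin n × Fin n → ℝ}, IsSwitchKernel P g amax W ((1 - ε) • ofMatrix ν) var →
      IsLimitLaw P π → 0 ≤ ε → ε ≤ ε₀ → ∀ r,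
        Integrable (fun x => ‖perpCone (toReal (g x))‖ ^ r) π.toMeasure ∧
          ∫ x, ‖perpCone (toReal (g x))‖ ^ r ∂π.toMeasure ≤ C r := by
  have hD : (0 : ℝ) < n * (amax + 1 : ℝ) := by positivity
  obtain ⟨θ, hθ, γ, b, hγ, hexp⟩ := exists_geometricDrift_exp hD hδ
    (2 * W + (n * (amax + 1 : ℝ)) ^ 2)
  obtain ⟨c, hc⟩ := exists_drift_fixed_point hγ b
  refine ⟨δ / (2 * (‖ofMatrix ν‖ + 1)), by positivity, fun r => r ! / θ ^ r * c, ?_⟩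
  intro S _ _ _ P π g ε var h hπ hε hεle r
  have hεδ : ε * ‖ofMatrix ν‖ ≤ δ / 2 := by
    rw [le_div_iff₀ (by positivity)] at hεle
    linarith
  have hdrift : GeometricDrift P
      (fun x => (Real.exp (θ * ‖perpCone (toReal (g x))‖)).toNNReal) γ b := by
    refine hexp P _ (fun x => ?_) fun x => ?_
    · exact (h.ae_norm_sub_le x).mono fun y hy => (abs_norm_perpCone_sub_le _ _).trans hy
    · obtain ⟨κ, hκ, hint⟩ := h.exists_isSlotLaw x
      rw [hint fun q => ‖perpCone (toReal q)‖ ^ 2]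
      exact hκ.integral_norm_sq_perpCone_nextQueue_le hν hδ.le hδν hε hεδ
  have hmean := hπ.mean_le_of_drift hγ hdrift hc
  have hinteg := integrable_exp_of_mean_le hmean
  refine ⟨integrable_pow_of_integrable_exp hθ (fun x => norm_nonneg _) hinteg r,
    (integral_pow_le_of_integrable_exp hθ (fun x => norm_nonneg _) hinteg r).trans ?_⟩
  exact mul_le_mul_of_nonneg_left (integral_exp_le_of_mean_le hmean) (by positivity)

theorem abs_mean_total_sub_le (hn : 0 < n)
    (h : IsSwitchKernel P g amax W ((1 - ε) • ofMatrix ν) var) (hπ : π.bind P = π)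
    (hν : ν ∈ doublyStochastic ℝ (Fin n))
    (htotal : Integrable (fun x => total (g x)) π.toMeasure)
    (hnorm : Integrable (fun x => ‖toReal (g x)‖ ^ 2) π.toMeasure) (hη : 0 < η) :
    |2 * ε * (∫ x, total (g x) ∂π.toMeasure) / n
        - ((2 * n - 1) / (n : ℝ) ^ 2 * ∑ p, var p + ε ^ 2)|
      ≤ η * ∫ x, ‖perpCone (toReal (g x))‖ ^ 2 ∂π.toMeasure + (1 / η + 1) * (n * ε) := by
  have hproj : Integrable (fun x => ‖projSpace n (toReal (g x))‖ ^ 2) π.toMeasure :=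
    hnorm.mono' Measurable.of_discrete.aestronglyMeasurable <| ae_of_all _ fun x => by
      rw [Real.norm_of_nonneg (by positivity)]
      gcongr
      exact norm_projSpace_le _
  have hperp : Integrable (fun x => ‖perpCone (toReal (g x))‖ ^ 2) π.toMeasure :=
    hnorm.mono' Measurable.of_discrete.aestronglyMeasurable <| ae_of_all _ fun x => by
      rw [Real.norm_of_nonneg (by positivity), norm_sq_eq_projCone_add_perpCone (toReal (g x))]
      linarith [sq_nonneg ‖projCone (toReal (g x))‖]
  have hbound := abs_integral_le_of_abs_drift_add_le hπ hproj
    ((hperp.const_mul η).add (htotal.const_mul (1 / η + 1)))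
    ((htotal.const_mul (2 * ε / n)).sub (integrable_const _))
    ((hperp.const_mul η).add (integrable_const _)) (h.abs_drift_norm_sq_projSpace_le hn hν hη)
  simp only [Pi.add_apply, Pi.sub_apply] at hbound
  rw [integral_sub (htotal.const_mul _) (integrable_const _),
    integral_add (hperp.const_mul _) (integrable_const _)] at hbound
  simp only [integral_const_mul, integral_const, probReal_univ, one_smul] at hbound
  convert hbound using 3
  ring

end IsSwitchKernel

/-! ### The heavy-traffic limit -/

theorem tendsto_heavyTraffic : Tendsto (fun ε : Param => (ε : ℝ)) heavyTraffic (𝓝 0) :=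
  tendsto_comap.mono_right nhdsWithin_le_nhds

theorem tendsto_mean_of_abs_sub_le {n : ℕ} (hn : 0 < n) {T : Param → ℝ}
    {var : Param → Fin n × Fin n → ℝ} {σsq : Fin n → Fin n → ℝ} {C ε₀ : ℝ} (hε₀ : 0 < ε₀)
    (hvar : ∀ p, Tendsto (fun ε => var ε p) heavyTraffic (𝓝 (σsq p.1 p.2)))
    (h : ∀ ε : Param, (ε : ℝ) ≤ ε₀ →
      |2 * ε * T ε / n - ((2 * n - 1) / (n : ℝ) ^ 2 * ∑ p, var ε p + (ε : ℝ) ^ 2)|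
        ≤ √(ε : ℝ) * C + (1 / √(ε : ℝ) + 1) * (n * ε)) :
    Tendsto (fun ε : Param => (ε : ℝ) * T ε) heavyTraffic
      (𝓝 ((1 - 1 / (2 * (n : ℝ))) * ∑ i, ∑ j, σsq i j)) := by
  have hsqrt : Tendsto (fun ε : Param => √(ε : ℝ)) heavyTraffic (𝓝 0) := by
    simpa using tendsto_heavyTraffic.sqrt
  have hbound : Tendsto (fun ε : Param => √(ε : ℝ) * C + (√(ε : ℝ) * n + n * ε)) heavyTraffic
      (𝓝 0) := by
    simpa using (hsqrt.mul_const C).add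
      ((hsqrt.mul_const (n : ℝ)).add (tendsto_heavyTraffic.const_mul (n : ℝ)))
  have hdiff : Tendsto (fun ε : Param => 2 * ε * T ε / n
      - ((2 * n - 1) / (n : ℝ) ^ 2 * ∑ p, var ε p + (ε : ℝ) ^ 2)) heavyTraffic (𝓝 0) := by
    refine squeeze_zero_norm' ?_ hbound
    filter_upwards [tendsto_heavyTraffic.eventually (eventually_le_nhds hε₀)] with ε hε
    refine (h ε hε).trans_eq ?_
    have hdiv : 1 / √(ε : ℝ) * ε = √(ε : ℝ) := by
      rw [one_div_mul_eq_div, Real.div_sqrt]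
    linear_combination (n : ℝ) * hdiv
  have hmain : Tendsto (fun ε : Param => (2 * n - 1) / (n : ℝ) ^ 2 * ∑ p, var ε p + (ε : ℝ) ^ 2)
      heavyTraffic (𝓝 ((2 * n - 1) / (n : ℝ) ^ 2 * ∑ p : Fin n × Fin n, σsq p.1 p.2 + 0 ^ 2)) :=
    ((tendsto_finsetSum _ fun p _ => hvar p).const_mul _).add (tendsto_heavyTraffic.pow 2)
  have hlim := (hdiff.add hmain).const_mul ((n : ℝ) / 2)
  rw [Fintype.sum_prod_type] at hlim
  convert hlim using 2 <;> field_simp <;> ring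

theorem exists_pos_forall_le {ι : Type*} [Finite ι] {f : ι → ℝ} (hf : ∀ i, 0 < f i) :
    ∃ δ > 0, ∀ i, δ ≤ f i := by
  cases isEmpty_or_nonempty ι with
  | inl => exact ⟨1, one_pos, isEmptyElim⟩
  | inr =>
    obtain ⟨i, hi⟩ := Finite.exists_min f
    exact ⟨f i, hf i, hi⟩

theorem total_le {n : ℕ} (q : PacketMatrix n) : total q ≤ (n : ℝ) ^ 2 * ‖toReal q‖ := by
  calc total q ≤ ∑ _i : Fin n, ∑ _j : Fin n, ‖toReal q‖ := by
        unfold total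
        gcongr with i _ j _
        simpa using PiLp.norm_apply_le (toReal q) (i, j)
    _ = (n : ℝ) ^ 2 * ‖toReal q‖ := by simp; ring

section QueueLaw

variable {S : Type*} [MeasurableSpace S] [DiscreteMeasurableSpace S] {n : ℕ}

/-- The law of the queue lengths `g x` of a random state `x` with law `π`. -/
noncomputable def queueLaw (π : PMF S) (g : S → PacketMatrix n) :
    ProbabilityMeasure (PacketMatrix n) :=
  ⟨π.toMeasure.map g, Measure.isProbabilityMeasure_map Measurable.of_discrete.aemeasurable⟩

variable {π : PMF S} {g : S → PacketMatrix n} {f : PacketMatrix n → ℝ}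

theorem integrable_queueLaw_iff :
    Integrable f (queueLaw π g : Measure (PacketMatrix n))
      ↔ Integrable (fun x => f (g x)) π.toMeasure :=
  integrable_map_measure Measurable.of_discrete.aestronglyMeasurable
    Measurable.of_discrete.aemeasurable

theorem integral_queueLaw :
    ∫ q, f q ∂(queueLaw π g : Measure (PacketMatrix n)) = ∫ x, f (g x) ∂π.toMeasure :=
  integral_map Measurable.of_discrete.aemeasurable Measurable.of_discrete.aestronglyMeasurable

theorem integrable_total (h : Integrable (fun x => ‖toReal (g x)‖ ^ 1) π.toMeasure) :
    Integrable (fun x => total (g x)) π.toMeasure :=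
  (h.const_mul ((n : ℝ) ^ 2)).mono' Measurable.of_discrete.aestronglyMeasurable <|
    ae_of_all _ fun x => by
      rw [Real.norm_of_nonneg (total_nonneg _), pow_one]
      exact total_le _

end QueueLaw

end InputQueuedSwitch

open InputQueuedSwitch in
theorem mainTheorem2_general {n : ℕ} (hn : 0 < n) {amax : ℕ} {ν : Matrix (Fin n) (Fin n) ℝ}
    (hν : ν ∈ doublyStochastic ℝ (Fin n)) (hνpos : ∀ i j, 0 < ν i j) {σsq : Fin n → Fin n → ℝ}
    {M : Param → SwitchSystem.{u} n} {var : Param → Fin n × Fin n → ℝ}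
    (hA : ∀ ε, (M ε).SecondOrderArrivals amax ((1 - (ε : ℝ)) • ofMatrix ν) (var ε))
    (hvar : ∀ p, Tendsto (fun ε => var ε p) heavyTraffic (𝓝 (σsq p.1 p.2)))
    {Y : ∀ ε, SwitchSystem.StateChain.{u, v} (M ε)} (hY : ClassTwo M Y) :
    AchievesSSC M Y ∧ MaxWeightLike M σsq := by
  obtain ⟨W, -, hW⟩ := hY
  choose hA1 g hA2 hnear using hW
  obtain ⟨δ, hδ, hδν'⟩ := exists_pos_forall_le fun p : Fin n × Fin n => hνpos p.1 p.2
  have hδν : ∀ i j, δ ≤ ν i j := fun i j => hδν' (i, j)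
  have hK := fun ε => (Y ε).isSwitchKernel (hA ε) (hA1 ε) (hA2 ε) (hnear ε)
  choose π hπ hnorm using fun ε => (hK ε).exists_isLimitLaw_integrable hn (hA1 ε).2.1 (hA1 ε).2.2
    (hA2 ε).2 hν hδ hδν ε.2.1
  obtain ⟨ε₀, hε₀, C, hC⟩ := IsSwitchKernel.exists_moment_norm_perpCone_le hn hν hδ hδν amax W
  have hperp := fun ε => hC (hK ε) (hπ ε) ε.2.1.le
  have hsteady : ∀ ε, (M ε).IsSteadyState (queueLaw (π ε) (g ε)) := fun ε =>
    (Y ε).isSteadyState (hπ ε) (hA2 ε) rfl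
  have htotal : ∀ ε, Integrable (fun x => total (g ε x)) (π ε).toMeasure := fun ε =>
    integrable_total (hnorm ε 1)
  refine ⟨⟨fun ε => (hπ ε).positiveRecurrent ((hπ ε).pos (hA1 ε).2.1),
    fun ε => ⟨hA1 ε, g ε, hA2 ε⟩, _, hsteady, ε₀, hε₀, C, fun ε hε r _ =>
      ⟨integrable_queueLaw_iff.2 (hperp ε hε r).1, integral_queueLaw.trans_le (hperp ε hε r).2⟩⟩,
    _, hsteady, fun ε => integrable_queueLaw_iff.2 (htotal ε), ?_⟩
  simp only [integral_queueLaw]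
  refine tendsto_mean_of_abs_sub_le (C := C 2) hn hε₀ hvar fun ε hε => ?_
  refine ((hK ε).abs_mean_total_sub_le hn (hπ ε).stationary hν (htotal ε) (hnorm ε 2)
    (Real.sqrt_pos.2 ε.2.1)).trans ?_
  gcongr
  exact (hperp ε hε 2).2

theorem mainTheorem2 (n : ℕ) (hn : 0 < n) (amax : ℕ)
    (ν : Matrix (Fin n) (Fin n) ℝ) (hν : ν ∈ doublyStochastic ℝ (Fin n))
    (hνpos : ∀ i j, 0 < ν i j) (σsq : Fin n → Fin n → ℝ)
    (M : InputQueuedSwitch.Param → InputQueuedSwitch.SwitchSystem.{u} n)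
    (hA : ∀ ε, (M ε).ArrivalAssumption amax)
    (hrate : ∀ ε i j, (M ε).arrivalRate i j = (1 - (ε : ℝ)) * ν i j)
    (hvar : ∀ i j, Filter.Tendsto (fun ε => (M ε).arrivalVariance i j)
      InputQueuedSwitch.heavyTraffic (nhds (σsq i j)))
    (Y : ∀ ε, InputQueuedSwitch.SwitchSystem.StateChain.{u, v} (M ε))
    (hY : InputQueuedSwitch.ClassTwo M Y) :
    InputQueuedSwitch.AchievesSSC M Y ∧ InputQueuedSwitch.MaxWeightLike M σsq :=
  mainTheorem2_general hn hν hνpos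
    (fun ε => (hA ε).secondOrderArrivals (hrate ε)) (fun p => hvar p.1 p.2) hY
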